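/- Let $k$ be a field of characteristic $p>0$ and $k[\boldsymbol{x}]=k[x_1,x_2,x_3]$ the polynomial ring in three variables over $k$. Let $l,m\ge 1$ and $t\ge 2$ be integers with $mt\ge 3$. Put $$f=x_1x_3-x_2^t,\qquad r=f^lx_2+x_1^m,\qquad g=x_1^{-1}\bigl(f^{lt+1}+r^t\bigr)\in k[\boldsymbol{x}],\qquad C=k[f^{\pm1},g^{\pm1}]\subset k(\boldsymbol{x}).$$ Then $f,g,r$ are algebraically independent over $k$, $k[\boldsymbol{x}]\subset C[r]$, and the homomorphism $\widetilde\epsilon: C[r]\to C[r][T]$, $u(r)\mapsto u(r+f^lgT)$, of $C$-algebras maps $k[\boldsymbol{x}]$ into $k[\boldsymbol{x}][T]$. Let $\epsilon: k[\boldsymbol{x}]\to k[\boldsymbol{x}][T]$ be its restriction (a $\mathbf{G}_a$-action). Put $k[\boldsymbol{x}]^{\epsilon}=\{a\mid \epsilon(a)=a\}$, and for $h\in k[\boldsymbol{x}]^{\epsilon}$ let $\epsilon_h: k[\boldsymbol{x}]\to k[\boldsymbol{x}]$, $b\mapsto\epsilon(b)|_{T=h}$, with invariant ring $k[\boldsymbol{x}]^{\epsilon_h}=\{b\mid\epsilon_h(b)=b\}$.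 Let $q=r^p-(f^lgh)^{p-1}r$, and let $\psi: C[r^p]\to C[q]$, $u(r^p)\mapsto u(q)$, be the substitution homomorphism of $C$-algebras; note that $x_1^p,x_2^p,x_3^p\in C[r^p]$. Theorem. Let $h\in k[\boldsymbol{x}]^{\epsilon}$. Assume that $p\nmid t$, $p\nmid mt-1$ and $h^{p-1}\in f^{l+1}g^2k[f,g]\setminus\{0\}$. (i) We have $k[\boldsymbol{x}]^{\epsilon_h}=\psi\bigl(k[x_1^p,x_2^p,x_3^p,f,g]\bigr)=k[\psi(x_1^p),\psi(x_2^p),\psi(x_3^p),f,g]$. (ii) The $k$-algebra $k[\boldsymbol{x}]^{\epsilon_h}$ is isomorphic to $k[x_1,x_2,x_3,y,z]/(y^p-f,\,z^p-g)$, where $k[x_1,x_2,x_3,y,z]$ is the polynomial ring in five variables over $k$, and it is not isomorphic to $k[x_1,x_2,x_3]$ as a $k$-algebra. -/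

import Mathlib

namespace RankThree

/-- Integers `l, m ≥ 1` and `t ≥ 2` with `m * t ≥ 3`. -/
structure Params where
  l : ℕ
  m : ℕ
  t : ℕ
  one_le_l : 1 ≤ l
  one_le_m : 1 ≤ m
  two_le_t : 2 ≤ t
  three_le_mt : 3 ≤ m * t

/-- If `s` is transcendental over `A` and `S = A[s]`, this is the substitution
`A[s] → B`, `u(s) ↦ u(b)`, as a homomorphism of `A`-algebras. -/
noncomputable def subst {A K B : Type*} [CommRing A] [CommRing K] [Algebra A K]
    [Semiring B] [Algebra A B] {s : K} (hs : Transcendental A s) (S : Subalgebra A K)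
    (hS : S = Algebra.adjoin A {s}) (b : B) : S →ₐ[A] B :=
  ((Polynomial.aeval b).comp
    (Polynomial.algEquivOfTranscendental A s hs).symm.toAlgHom).comp
      (Subalgebra.equivOfEq S _ hS).toAlgHom

theorem subst_gen {A K B : Type*} [CommRing A] [CommRing K] [Algebra A K]
    [Semiring B] [Algebra A B] {s : K} (hs : Transcendental A s) (S : Subalgebra A K)
    (hS : S = Algebra.adjoin A {s}) (b : B) (h : s ∈ S) : subst hs S hS b ⟨s, h⟩ = b := by
  subst hS
  have : (Polynomial.algEquivOfTranscendental A s hs).symm ⟨s, h⟩ = Polynomial.X := by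
    rw [AlgEquiv.symm_apply_eq]
    ext
    simp
  simp [subst, this]

variable (k : Type*) [Field k] (D : Params)

/-- The polynomial ring `k[x₁, x₂, x₃]`; the variable `xᵢ₊₁` is `X i` for `i : Fin 3`. -/
abbrev Poly := MvPolynomial (Fin 3) k

/-- The field of rational functions `k(x₁, x₂, x₃)`. -/
abbrev Frac := FractionRing (Poly k)

open MvPolynomial in
/-- `f = x₁ x₃ - x₂ ^ t`. -/
noncomputable def f : Poly k := X 0 * X 2 - X 1 ^ D.t

open MvPolynomial in
/-- `r = f ^ l * x₂ + x₁ ^ m`. -/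
noncomputable def r : Poly k := f k D ^ D.l * X 1 + X 0 ^ D.m

open MvPolynomial in
/-- The polynomial `g = x₁⁻¹ (f ^ (l t + 1) + r ^ t)`, see `X_mul_g`. It is written here without
division, using
`r ^ t - (f ^ l x₂) ^ t = x₁ ^ m * ∑_{i < t} r ^ i (f ^ l x₂) ^ (t - 1 - i)`. -/
noncomputable def g : Poly k :=
  f k D ^ (D.l * D.t) * X 2 +
    X 0 ^ (D.m - 1) *
      ∑ i ∈ Finset.range D.t, r k D ^ i * (f k D ^ D.l * X 1) ^ (D.t - 1 - i)

open MvPolynomial in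
/-- This identity characterizes `g`. -/
theorem X_mul_g : X 0 * g k D = f k D ^ (D.l * D.t + 1) + r k D ^ D.t := by
  have h1 := (Commute.all (r k D) (f k D ^ D.l * X 1)).geom_sum₂_mul D.t
  have h2 : r k D - f k D ^ D.l * X 1 = X 0 * X 0 ^ (D.m - 1) := by
    rw [← pow_succ', Nat.sub_add_cancel D.one_le_m, r]; ring
  rw [h2] at h1
  have h3 : X 0 * X 2 = f k D + X 1 ^ D.t := by rw [f]; ring
  rw [g]
  linear_combination h1 + f k D ^ (D.l * D.t) * h3

theorem f_ne_zero : f k D ≠ 0 := by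
  intro h
  have := congrArg (MvPolynomial.eval ![1, 0, 1]) h
  have ht : D.t ≠ 0 := by have := D.two_le_t; omega
  simp [f, ht] at this

theorem g_ne_zero : g k D ≠ 0 := by
  intro h
  have := congrArg (MvPolynomial.eval ![1, 0, 0]) h
  have ht : D.t ≠ 0 := by have := D.two_le_t; omega
  have hl : D.l ≠ 0 := by have := D.one_le_l; omega
  rw [g] at this
  simp only [f, r, map_add, map_mul, map_pow, map_sub, map_sum, MvPolynomial.eval_X] at this
  simp [ht, hl] at this
  rw [Finset.sum_eq_single (D.t - 1)] at this
  · simp at this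
  · intro i hi hne
    rw [zero_pow]
    have := Finset.mem_range.1 hi
    omega
  · intro h0
    exact absurd (Finset.mem_range.2 (by omega)) h0

noncomputable instance : Field (Frac k) := inferInstance
noncomputable instance : CommRing (Frac k) := inferInstance
noncomputable instance : Algebra k (Frac k) := inferInstance

/-- The inclusion `k[x₁, x₂, x₃] ⊆ k(x₁, x₂, x₃)`. -/
noncomputable def toFrac : Poly k →ₐ[k] Frac k := IsScalarTower.toAlgHom k (Poly k) (Frac k)

theorem toFrac_injective : Function.Injective (toFrac k) :=
  IsFractionRing.injective (Poly k) (Frac k)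

/-- `C = k[f, f⁻¹, g, g⁻¹]`, as a subring of `k(x₁, x₂, x₃)`. -/
noncomputable def C : Subalgebra k (Frac k) :=
  Algebra.adjoin k {toFrac k (f k D), (toFrac k (f k D))⁻¹,
    toFrac k (g k D), (toFrac k (g k D))⁻¹}

noncomputable instance : CommRing (C k D) := (C k D).toCommRing
noncomputable instance : IsDomain (C k D) := inferInstance
noncomputable instance : Algebra k (C k D) := (C k D).algebra
noncomputable instance : Algebra (C k D) (Frac k) := (C k D).toAlgebra
instance : IsScalarTower k (C k D) (Frac k) := inferInstance

theorem f_mem_C : toFrac k (f k D) ∈ C k D := Algebra.subset_adjoin (by simp)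
theorem f_inv_mem_C : (toFrac k (f k D))⁻¹ ∈ C k D := Algebra.subset_adjoin (by simp)
theorem g_mem_C : toFrac k (g k D) ∈ C k D := Algebra.subset_adjoin (by simp)
theorem g_inv_mem_C : (toFrac k (g k D))⁻¹ ∈ C k D := Algebra.subset_adjoin (by simp)

theorem tf_ne_zero : toFrac k (f k D) ≠ 0 :=
  (map_ne_zero_iff _ (toFrac_injective k)).2 (f_ne_zero k D)

theorem tg_ne_zero : toFrac k (g k D) ≠ 0 :=
  (map_ne_zero_iff _ (toFrac_injective k)).2 (g_ne_zero k D)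

/-- `x₁ = g⁻¹ (f ^ (l t + 1) + r ^ t)`. -/
theorem x0_eq : toFrac k (MvPolynomial.X 0) = (toFrac k (g k D))⁻¹ *
    (toFrac k (f k D) ^ (D.l * D.t + 1) + toFrac k (r k D) ^ D.t) := by
  rw [eq_inv_mul_iff_mul_eq₀ (tg_ne_zero k D)]
  rw [← map_pow, ← map_pow, ← map_add, ← X_mul_g, map_mul, mul_comm]

/-- `x₂ = f ^ (-l) (r - x₁ ^ m)`. -/
theorem x1_eq : toFrac k (MvPolynomial.X 1) = (toFrac k (f k D))⁻¹ ^ D.l *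
    (toFrac k (r k D) - toFrac k (MvPolynomial.X 0) ^ D.m) := by
  rw [inv_pow, eq_inv_mul_iff_mul_eq₀ (pow_ne_zero _ (tf_ne_zero k D))]
  simp [r]

/-- `x₃ = f ^ (-l t) (g - ⋯)`. -/
theorem x2_eq : toFrac k (MvPolynomial.X 2) = (toFrac k (f k D))⁻¹ ^ (D.l * D.t) *
    (toFrac k (g k D) - toFrac k (MvPolynomial.X 0) ^ (D.m - 1) *
      ∑ i ∈ Finset.range D.t, toFrac k (r k D) ^ i *
        (toFrac k (f k D) ^ D.l * toFrac k (MvPolynomial.X 1)) ^ (D.t - 1 - i)) := by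
  rw [inv_pow, eq_inv_mul_iff_mul_eq₀ (pow_ne_zero _ (tf_ne_zero k D))]
  rw [g]
  simp

/-- `f, g, r` are algebraically independent over `k`. -/
theorem algebraicIndependent_fgr :
    AlgebraicIndependent k ![toFrac k (f k D), toFrac k (g k D), toFrac k (r k D)] := by
  set v : Fin 3 → Frac k := ![toFrac k (f k D), toFrac k (g k D), toFrac k (r k D)] with hv
  have hgen : ∀ i, IsAlgebraic (Algebra.adjoin k (Set.range v)) (v i) := fun i =>
    isAlgebraic_algebraMap (⟨v i, Algebra.subset_adjoin ⟨i, rfl⟩⟩ :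
      Algebra.adjoin k (Set.range v))
  have hF : IsAlgebraic (Algebra.adjoin k (Set.range v)) (toFrac k (f k D)) := hgen 0
  have hG : IsAlgebraic (Algebra.adjoin k (Set.range v)) (toFrac k (g k D)) := hgen 1
  have hR : IsAlgebraic (Algebra.adjoin k (Set.range v)) (toFrac k (r k D)) := hgen 2
  have h0 : IsAlgebraic (Algebra.adjoin k (Set.range v)) (toFrac k (MvPolynomial.X 0)) := by
    rw [x0_eq k D]
    exact hG.inv.mul ((hF.pow _).add (hR.pow _))
  have h1 : IsAlgebraic (Algebra.adjoin k (Set.range v)) (toFrac k (MvPolynomial.X 1)) := by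
    rw [x1_eq k D]
    exact (hF.inv.pow _).mul (hR.sub (h0.pow _))
  have h2 : IsAlgebraic (Algebra.adjoin k (Set.range v)) (toFrac k (MvPolynomial.X 2)) := by
    rw [x2_eq k D]
    refine (hF.inv.pow _).mul (hG.sub ((h0.pow _).mul ?_))
    refine Finset.sum_induction _ (IsAlgebraic (Algebra.adjoin k (Set.range v)))
      (fun _ _ ha hb => ha.add hb) isAlgebraic_zero fun i _ => ?_
    exact (hR.pow _).mul (((hF.pow _).mul h1).pow _)
  have hp : ∀ a : Poly k, IsAlgebraic (Algebra.adjoin k (Set.range v)) (toFrac k a) := by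
    intro a
    induction a using MvPolynomial.induction_on with
    | C c =>
      have : toFrac k (MvPolynomial.C c) =
          algebraMap (Algebra.adjoin k (Set.range v)) (Frac k)
            (algebraMap k (Algebra.adjoin k (Set.range v)) c) := by
        rw [← IsScalarTower.algebraMap_apply]
        exact (toFrac k).commutes c
      rw [this]
      exact isAlgebraic_algebraMap _
    | add a b ha hb => rw [map_add]; exact ha.add hb
    | mul_X a i ha =>
      rw [map_mul]
      refine ha.mul ?_
      fin_cases i
      · exact h0
      · exact h1
      · exact h2
  have halg : Algebra.IsAlgebraic (Algebra.adjoin k (Set.range v)) (Frac k) := by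
    refine ⟨fun x => ?_⟩
    obtain ⟨a, b, -, rfl⟩ := IsFractionRing.div_surjective (A := Poly k) x
    rw [div_eq_mul_inv]
    exact (hp a).mul (hp b).inv
  refine (Algebra.IsAlgebraic.isTranscendenceBasis_of_lift_le_trdeg_of_finite k v ?_).1
  have hX : AlgebraicIndependent k (fun i : Fin 3 => toFrac k (MvPolynomial.X i)) := by
    have := (MvPolynomial.algebraicIndependent_X (Fin 3) k).map'
      (f := toFrac k) (toFrac_injective k)
    exact this
  exact hX.lift_cardinalMk_le_trdeg

theorem transcendental_of_forall_isAlgebraic {k K : Type*} [Field k] [Field K] [Algebra k K]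
    (A E : Subalgebra k K) (hE : ∀ x ∈ E, IsAlgebraic A x) {y : K} (hy : Transcendental A y) :
    Transcendental E y := by
  have hle : E ≤ (Subalgebra.algebraicClosure A K).restrictScalars k := fun x hx => hE x hx
  rintro ⟨P, hP0, hP⟩
  apply hy
  have h2 : IsAlgebraic (Subalgebra.algebraicClosure A K) y := by
    let i : E →+* Subalgebra.algebraicClosure A K := (Subalgebra.inclusion hle).toRingHom
    have hi : Function.Injective i := Subalgebra.inclusion_injective hle
    refine ⟨P.map i, (Polynomial.map_ne_zero_iff hi).2 hP0, ?_⟩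
    rw [Polynomial.aeval_def, Polynomial.eval₂_map]
    exact hP
  exact h2.restrictScalars A

/-- `r` is transcendental over `C`. -/
theorem transcendental_r : Transcendental (C k D) (toFrac k (r k D)) := by
  have hv := algebraicIndependent_fgr k D
  set v : Fin 3 → Frac k := ![toFrac k (f k D), toFrac k (g k D), toFrac k (r k D)] with hvd
  have htr : Transcendental (Algebra.adjoin k (v '' {0, 1})) (v 2) :=
    hv.transcendental_adjoin (by decide)
  have hgen : ∀ i ∈ ({0, 1} : Set (Fin 3)),
      IsAlgebraic (Algebra.adjoin k (v '' {0, 1})) (v i) := fun i hi =>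
    isAlgebraic_algebraMap (⟨v i, Algebra.subset_adjoin ⟨i, hi, rfl⟩⟩ :
      Algebra.adjoin k (v '' {0, 1}))
  have hF : IsAlgebraic (Algebra.adjoin k (v '' {0, 1})) (toFrac k (f k D)) := hgen 0 (by simp)
  have hG : IsAlgebraic (Algebra.adjoin k (v '' {0, 1})) (toFrac k (g k D)) := hgen 1 (by simp)
  refine transcendental_of_forall_isAlgebraic _ _ (fun x hx => ?_) htr
  induction hx using Algebra.adjoin_induction with
  | mem x hx =>
    rcases hx with rfl | rfl | rfl | rfl
    · exact hF
    · exact hF.inv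
    · exact hG
    · exact hG.inv
  | algebraMap c =>
    rw [IsScalarTower.algebraMap_apply k (Algebra.adjoin k (v '' {0, 1})) (Frac k)]
    exact isAlgebraic_algebraMap _
  | add x y _ _ hx hy => exact hx.add hy
  | mul x y _ _ hx hy => exact hx.mul hy

/-- `C[r]`. -/
noncomputable def Cr : Subalgebra (C k D) (Frac k) :=
  Algebra.adjoin (C k D) {toFrac k (r k D)}

noncomputable instance : CommRing (Cr k D) := (Cr k D).toCommRing
noncomputable instance : IsDomain (Cr k D) := inferInstance
noncomputable instance : Algebra (C k D) (Cr k D) := (Cr k D).algebra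
noncomputable instance : Module (C k D) (Cr k D) := Algebra.toModule
noncomputable instance : SMul (C k D) (Cr k D) := Algebra.toSMul
noncomputable instance : Algebra k (Cr k D) := (Cr k D).algebra'
noncomputable instance : Module k (Cr k D) := Algebra.toModule
noncomputable instance : SMul k (Cr k D) := Algebra.toSMul
instance : IsScalarTower k (C k D) (Cr k D) := inferInstance
noncomputable instance : CommRing (Polynomial (Cr k D)) := Polynomial.commRing
noncomputable instance : IsDomain (Polynomial (Cr k D)) := inferInstance
noncomputable instance : Algebra k (Polynomial (Cr k D)) := Polynomial.algebraOfAlgebra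
noncomputable instance : Algebra (C k D) (Polynomial (Cr k D)) := Polynomial.algebraOfAlgebra
instance : IsScalarTower k (C k D) (Polynomial (Cr k D)) := inferInstance

theorem r_mem_Cr : toFrac k (r k D) ∈ Cr k D := Algebra.subset_adjoin rfl

theorem x_mem_of {S : Subalgebra (C k D) (Frac k)} (hr : toFrac k (r k D) ∈ S) (a : Poly k) :
    toFrac k a ∈ S := by
  have hc : ∀ {x : Frac k}, x ∈ C k D → x ∈ S := fun {x} hx =>
    S.algebraMap_mem (⟨x, hx⟩ : C k D)
  have hF := hc (f_mem_C k D)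
  have hFi := hc (f_inv_mem_C k D)
  have hG := hc (g_mem_C k D)
  have hGi := hc (g_inv_mem_C k D)
  have h0 : toFrac k (MvPolynomial.X 0) ∈ S := by
    rw [x0_eq k D]
    exact mul_mem hGi (add_mem (pow_mem hF _) (pow_mem hr _))
  have h1 : toFrac k (MvPolynomial.X 1) ∈ S := by
    rw [x1_eq k D]
    exact mul_mem (pow_mem hFi _) (sub_mem hr (pow_mem h0 _))
  have h2 : toFrac k (MvPolynomial.X 2) ∈ S := by
    rw [x2_eq k D]
    exact mul_mem (pow_mem hFi _) (sub_mem hG (mul_mem (pow_mem h0 _)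
      (sum_mem fun i _ => mul_mem (pow_mem hr _) (pow_mem (mul_mem (pow_mem hF _) h1) _))))
  induction a using MvPolynomial.induction_on with
  | C c =>
    have : toFrac k (MvPolynomial.C c) = algebraMap k (Frac k) c := (toFrac k).commutes c
    rw [this]
    exact hc ((C k D).algebraMap_mem c)
  | add a b ha hb => rw [map_add]; exact add_mem ha hb
  | mul_X a i ha =>
    rw [map_mul]
    refine mul_mem ha ?_
    fin_cases i
    · exact h0
    · exact h1
    · exact h2

/-- The inclusion `k[x₁, x₂, x₃] ⊆ C[r]`. -/
noncomputable def incl : Poly k →ₐ[k] Cr k D :=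
  (toFrac k).codRestrict ((Cr k D).restrictScalars k) (x_mem_of k D (r_mem_Cr k D))

theorem incl_injective : Function.Injective (incl k D) := fun _ _ h =>
  toFrac_injective k (congrArg Subtype.val h)

/-- `ε̃ : C[r] → C[r][T]`, `u(r) ↦ u(r + f ^ l g T)`. -/
noncomputable def epsilonTilde : Cr k D →ₐ[C k D] Polynomial (Cr k D) :=
  subst (transcendental_r k D) (Cr k D) rfl
    (Polynomial.C (incl k D (r k D)) +
      Polynomial.C (incl k D (f k D ^ D.l * g k D)) * Polynomial.X)

theorem epsilonTilde_r : epsilonTilde k D (incl k D (r k D)) =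
    Polynomial.C (incl k D (r k D)) +
      Polynomial.C (incl k D (f k D ^ D.l * g k D)) * Polynomial.X := by
  have h : incl k D (r k D) = ⟨toFrac k (r k D), r_mem_Cr k D⟩ := Subtype.ext rfl
  rw [epsilonTilde, h]
  exact subst_gen (transcendental_r k D) (Cr k D) rfl _ (r_mem_Cr k D)

/-- The inclusion `k[x₁, x₂, x₃][T] ⊆ C[r][T]`. -/
noncomputable def inclT : Polynomial (Poly k) →ₐ[k] Polynomial (Cr k D) :=
  Polynomial.mapAlgHom (incl k D)

theorem inclT_injective : Function.Injective (inclT k D) :=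
  Polynomial.map_injective (incl k D).toRingHom (incl_injective k D)

theorem inclT_C (a : Poly k) : inclT k D (Polynomial.C a) = Polynomial.C (incl k D a) := by
  simp [inclT]

theorem inclT_X : inclT k D Polynomial.X = Polynomial.X := by
  simp [inclT]

theorem epsilonTilde_of_mem (a : Poly k) (ha : toFrac k a ∈ C k D) :
    epsilonTilde k D (incl k D a) = inclT k D (Polynomial.C a) := by
  rw [inclT_C]
  exact (epsilonTilde k D).commutes ⟨toFrac k a, ha⟩

open Polynomial in
theorem dvd_of_dvd_mul (n : ℕ) (u y : Polynomial (Poly k))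
    (h : Polynomial.C (f k D) ^ n ∣
      (Polynomial.C (MvPolynomial.X 0) + Polynomial.C (f k D) * u) * y) :
    Polynomial.C (f k D) ^ n ∣ y := by
  have hx : Prime (Polynomial.C (MvPolynomial.X 0 : Poly k)) :=
    Polynomial.prime_C_iff.2 MvPolynomial.X_prime
  have hf0 : Polynomial.C (f k D) ≠ 0 := by simpa using f_ne_zero k D
  have hndvd : ¬ Polynomial.C (MvPolynomial.X 0 : Poly k) ∣ Polynomial.C (f k D) := by
    intro hd
    have hd : (MvPolynomial.X 0 : Poly k) ∣ f k D :=
      (Polynomial.C_dvd_iff_dvd_coeff _ _).1 hd 0 |>.trans (by simp)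
    obtain ⟨c, hc⟩ := hd
    have := congrArg (MvPolynomial.eval ![0, 1, 0]) hc
    simp [f] at this
  have key : ∀ y, Polynomial.C (f k D) ∣ Polynomial.C (MvPolynomial.X 0) * y →
      Polynomial.C (f k D) ∣ y := by
    rintro y ⟨b, hb⟩
    have : Polynomial.C (MvPolynomial.X 0 : Poly k) ∣ Polynomial.C (f k D) * b := ⟨y, hb.symm⟩
    obtain ⟨b', rfl⟩ := (hx.dvd_or_dvd this).resolve_left hndvd
    exact ⟨b', mul_left_cancel₀ hx.ne_zero (by linear_combination hb)⟩
  induction n with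
  | zero => simp
  | succ n ih =>
    obtain ⟨z, hz⟩ := ih ((pow_dvd_pow _ n.le_succ).trans h)
    obtain ⟨w, hw⟩ := h
    subst hz
    have h1 : (Polynomial.C (MvPolynomial.X 0) + Polynomial.C (f k D) * u) * z =
        Polynomial.C (f k D) * w := by
      apply mul_left_cancel₀ (pow_ne_zero n hf0)
      linear_combination hw
    have h2 : Polynomial.C (f k D) ∣ z :=
      key z ⟨w - u * z, by linear_combination h1⟩
    rw [pow_succ]
    exact mul_dvd_mul_left _ h2

/-- Auxiliary form of `epsilonTilde_incl_mem`. -/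
theorem mem_range_aux {B : Type*} [CommRing B] [IsDomain B] [Algebra k B]
    (ε : Poly k →ₐ[k] B) (j : Polynomial (Poly k) →ₐ[k] B) (hj : Function.Injective j)
    (T : Polynomial (Poly k)) (c : Poly k →+* Polynomial (Poly k)) (hcd : c = Polynomial.C)
    (hF : ε (f k D) = j (c (f k D))) (hG : ε (g k D) = j (c (g k D)))
    (hR : ε (r k D) = j (c (r k D) + c (f k D ^ D.l * g k D) * T)) (a : Poly k) :
    ε a ∈ j.range := by
  have hf0 : c (f k D) ≠ 0 := by simpa [hcd] using f_ne_zero k D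
  have hg0 : c (g k D) ≠ 0 := by simpa [hcd] using g_ne_zero k D
  have hjf0 : j (c (f k D)) ≠ 0 := (map_ne_zero_iff _ hj).2 hf0
  have hjg0 : j (c (g k D)) ≠ 0 := (map_ne_zero_iff _ hj).2 hg0
  set F := c (f k D) with hFd
  set G := c (g k D) with hGd
  set R := c (r k D) with hRd
  have hR' : ε (r k D) = j (R + F ^ D.l * G * T) := by rw [hR]; simp [F, G]
  set x0 := c (MvPolynomial.X 0) with hx0
  set x1 := c (MvPolynomial.X 1) with hx1
  set x2 := c (MvPolynomial.X 2) with hx2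
  have e1 : x0 * G = F ^ (D.l * D.t + 1) + R ^ D.t := by
    rw [hx0, hGd, ← map_mul, X_mul_g]; simp [F, R]
  have e2 : R = F ^ D.l * x1 + x0 ^ D.m := by
    simp only [hRd, r, map_add, map_mul, map_pow, ← hFd, ← hx0, ← hx1]
  obtain ⟨S, hS⟩ : ∃ S, (R + F ^ D.l * G * T) ^ D.t - R ^ D.t = F ^ D.l * G * T * S := by
    have := sub_dvd_pow_sub_pow (R + F ^ D.l * G * T) R D.t
    rwa [add_sub_cancel_left] at this
  have E0 : ε (MvPolynomial.X 0) = j (x0 + F ^ D.l * (T * S)) := by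
    apply mul_right_cancel₀ hjg0
    have h := congrArg ε (X_mul_g k D)
    rw [map_mul, map_add, map_pow ε, map_pow ε, hG, hF, hR', ← map_pow j, ← map_pow j, ← map_add] at h
    rw [h, ← map_mul]
    apply congrArg j
    linear_combination hS - e1
  obtain ⟨S', hS'⟩ : ∃ S', (x0 + F ^ D.l * (T * S)) ^ D.m - x0 ^ D.m =
      F ^ D.l * (T * S) * S' := by
    have := sub_dvd_pow_sub_pow (x0 + F ^ D.l * (T * S)) x0 D.m
    rwa [add_sub_cancel_left] at this
  have E1 : ε (MvPolynomial.X 1) = j (x1 + (G * T - T * S * S')) := by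
    apply mul_left_cancel₀ (pow_ne_zero D.l hjf0)
    have h : ε (r k D) = ε (f k D) ^ D.l * ε (MvPolynomial.X 1) + ε (MvPolynomial.X 0) ^ D.m := by
      rw [r]; simp only [map_add, map_mul, map_pow]
    rw [hR', hF, E0] at h
    have h' : j F ^ D.l * ε (MvPolynomial.X 1) =
        j (R + F ^ D.l * G * T - (x0 + F ^ D.l * (T * S)) ^ D.m) := by
      rw [map_sub, map_pow j (x0 + F ^ D.l * (T * S)), h]; ring
    rw [h', ← map_pow j, ← map_mul]
    apply congrArg j
    linear_combination e2 - hS'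
  set X0 := x0 + F ^ D.l * (T * S) with hX0
  set X1 := x1 + (G * T - T * S * S') with hX1
  have E2 : ∃ Z, ε (MvPolynomial.X 2) = j Z := by
    have ha : j X0 * ε (MvPolynomial.X 2) = j (F + X1 ^ D.t) := by
      rw [map_add j F, map_pow, ← E0, ← E1, ← hF, ← map_mul, ← map_pow, ← map_add]
      apply congrArg ε
      rw [f]; ring
    have hb : j F ^ (D.l * D.t) * ε (MvPolynomial.X 2) = j (G - X0 ^ (D.m - 1) *
        ∑ i ∈ Finset.range D.t, (R + F ^ D.l * G * T) ^ i * (F ^ D.l * X1) ^ (D.t - 1 - i)) := by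
      have h : ε (g k D) = ε (f k D) ^ (D.l * D.t) * ε (MvPolynomial.X 2) +
          ε (MvPolynomial.X 0) ^ (D.m - 1) * ∑ i ∈ Finset.range D.t, ε (r k D) ^ i *
            (ε (f k D) ^ D.l * ε (MvPolynomial.X 1)) ^ (D.t - 1 - i) := by
        rw [g]; simp only [map_add, map_mul, map_pow, map_sum]
      rw [hG, hF, hR', E0, E1] at h
      rw [map_sub, h]
      simp only [← map_pow, ← map_mul, ← map_sum]
      ring
    set Y := G - X0 ^ (D.m - 1) *
        ∑ i ∈ Finset.range D.t, (R + F ^ D.l * G * T) ^ i * (F ^ D.l * X1) ^ (D.t - 1 - i)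
    have hc : X0 * Y = F ^ (D.l * D.t) * (F + X1 ^ D.t) := by
      apply hj
      rw [map_mul, map_mul, ← ha, ← hb, map_pow]
      ring
    have hl : F ^ D.l = F * F ^ (D.l - 1) := by
      rw [← pow_succ', Nat.sub_add_cancel D.one_le_l]
    have hX0' : X0 = x0 + F * (F ^ (D.l - 1) * (T * S)) := by
      rw [hX0, hl]; ring
    have hd : F ^ (D.l * D.t) ∣ (x0 + F * (F ^ (D.l - 1) * (T * S))) * Y :=
      ⟨F + X1 ^ D.t, by rw [← hX0', hc]⟩
    rw [hx0, hFd, hcd] at hd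
    have hd' := dvd_of_dvd_mul k D _ _ _ hd
    rw [← hcd, ← hFd] at hd'
    obtain ⟨Z, hZ⟩ := hd'
    refine ⟨Z, ?_⟩
    apply mul_left_cancel₀ (pow_ne_zero (D.l * D.t) hjf0)
    rw [hb, hZ, map_mul j, map_pow j]
  induction a using MvPolynomial.induction_on with
  | C a =>
    have : ε (MvPolynomial.C a) = algebraMap k _ a := ε.commutes a
    rw [this]
    exact j.range.algebraMap_mem a
  | add a b ha hb => rw [map_add]; exact add_mem ha hb
  | mul_X a i ha =>
    rw [map_mul]
    refine mul_mem ha ?_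
    fin_cases i
    · exact ⟨_, E0.symm⟩
    · exact ⟨_, E1.symm⟩
    · exact E2.imp fun Z hZ => hZ.symm

/-- `ε̃` maps `k[x₁, x₂, x₃]` into `k[x₁, x₂, x₃][T]`. -/
theorem epsilonTilde_incl_mem (a : Poly k) :
    epsilonTilde k D (incl k D a) ∈ (inclT k D).range := by
  refine mem_range_aux k D (((epsilonTilde k D).restrictScalars k).comp (incl k D)) (inclT k D)
    (inclT_injective k D) Polynomial.X Polynomial.C rfl
    (epsilonTilde_of_mem k D _ (f_mem_C k D)) (epsilonTilde_of_mem k D _ (g_mem_C k D)) ?_ a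
  have h := epsilonTilde_r k D
  rw [← inclT_C, ← inclT_C, ← inclT_X, ← map_mul, ← map_add] at h
  exact h

/-- The `G_a`-action `ε : k[x₁, x₂, x₃] → k[x₁, x₂, x₃][T]`, the restriction of `ε̃`
(see `inclT_epsilon`). -/
noncomputable def epsilon : Poly k →ₐ[k] Polynomial (Poly k) :=
  (AlgEquiv.ofInjective (inclT k D) (inclT_injective k D)).symm.toAlgHom.comp
    ((((epsilonTilde k D).restrictScalars k).comp (incl k D)).codRestrict (inclT k D).range
      (epsilonTilde_incl_mem k D))

theorem inclT_epsilon (a : Poly k) :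
    inclT k D (epsilon k D a) = epsilonTilde k D (incl k D a) := by
  have h := AlgEquiv.apply_symm_apply (AlgEquiv.ofInjective (inclT k D) (inclT_injective k D))
    ⟨epsilonTilde k D (incl k D a), epsilonTilde_incl_mem k D a⟩
  exact congrArg Subtype.val h

/-- The invariant ring `k[x₁, x₂, x₃]^ε = {a | ε(a) = a}` of the `G_a`-action `ε`. -/
noncomputable def epsilonInvariants : Subalgebra k (Poly k) :=
  AlgHom.equalizer (epsilon k D) Polynomial.CAlgHom

/-- `ε_h : b ↦ ε(b)|_{T = h}`. -/
noncomputable def epsilonAt (h : Poly k) : Poly k →ₐ[k] Poly k :=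
  ((Polynomial.aeval h).restrictScalars k).comp (epsilon k D)

/-- The invariant ring `{b | φ(b) = b}` of an endomorphism `φ` of `k[x₁, x₂, x₃]`. -/
noncomputable def invariants (φ : Poly k →ₐ[k] Poly k) : Subalgebra k (Poly k) :=
  AlgHom.equalizer φ (AlgHom.id k (Poly k))

variable (p : ℕ) [hp : Fact p.Prime]

/-- `C[r ^ p]`. -/
noncomputable def Crp : Subalgebra (C k D) (Frac k) :=
  Algebra.adjoin (C k D) {toFrac k (r k D) ^ p}

noncomputable instance : CommRing (Crp k D p) := (Crp k D p).toCommRing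
noncomputable instance : IsDomain (Crp k D p) := inferInstance
noncomputable instance : Algebra (C k D) (Crp k D p) := (Crp k D p).algebra
noncomputable instance : Module (C k D) (Crp k D p) := Algebra.toModule
noncomputable instance : SMul (C k D) (Crp k D p) := Algebra.toSMul
noncomputable instance : Algebra k (Crp k D p) := (Crp k D p).algebra'
noncomputable instance : Module k (Crp k D p) := Algebra.toModule
noncomputable instance : SMul k (Crp k D p) := Algebra.toSMul
instance : IsScalarTower k (C k D) (Crp k D p) := inferInstance

/-- `q = r ^ p - (f ^ l g h) ^ (p - 1) r`. -/
noncomputable def q (h : Poly k) : Poly k :=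
  r k D ^ p - (f k D ^ D.l * g k D * h) ^ (p - 1) * r k D

/-- `C[q]`. -/
noncomputable def Cq (h : Poly k) : Subalgebra (C k D) (Frac k) :=
  Algebra.adjoin (C k D) {toFrac k (q k D p h)}

noncomputable instance (h : Poly k) : CommRing (Cq k D p h) := (Cq k D p h).toCommRing
noncomputable instance (h : Poly k) : IsDomain (Cq k D p h) := inferInstance
noncomputable instance (h : Poly k) : Algebra (C k D) (Cq k D p h) := (Cq k D p h).algebra
noncomputable instance (h : Poly k) : Module (C k D) (Cq k D p h) := Algebra.toModule
noncomputable instance (h : Poly k) : SMul (C k D) (Cq k D p h) := Algebra.toSMul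
noncomputable instance (h : Poly k) : Algebra k (Cq k D p h) := (Cq k D p h).algebra'
noncomputable instance (h : Poly k) : Module k (Cq k D p h) := Algebra.toModule
noncomputable instance (h : Poly k) : SMul k (Cq k D p h) := Algebra.toSMul
instance (h : Poly k) : IsScalarTower k (C k D) (Cq k D p h) := inferInstance

/-- `ψ : C[r ^ p] → C[q]`, `u(r ^ p) ↦ u(q)`. -/
noncomputable def psi (h : Poly k) : Crp k D p →ₐ[C k D] Cq k D p h :=
  subst ((transcendental_r k D).pow hp.out.pos) (Crp k D p) rfl
    ⟨toFrac k (q k D p h), Algebra.subset_adjoin rfl⟩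

/-- `ψ` with values in `k(x₁, x₂, x₃) ⊇ C[q]`, as a homomorphism of `k`-algebras. -/
noncomputable def psiFrac (h : Poly k) : Crp k D p →ₐ[k] Frac k :=
  ((Cq k D p h).val.comp (psi k D p h)).restrictScalars k

theorem x_pow_mem_Crp [CharP k p] (i : Fin 3) :
    toFrac k (MvPolynomial.X i) ^ p ∈ Crp k D p := by
  have : CharP (Frac k) p := charP_of_injective_algebraMap (algebraMap k (Frac k)).injective p
  have hr : toFrac k (r k D) ^ p ∈ Crp k D p := Algebra.subset_adjoin rfl
  have hc : ∀ {x : Frac k}, x ∈ C k D → frobenius (Frac k) p x ∈ Crp k D p := fun {x} hx =>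
    pow_mem ((Crp k D p).algebraMap_mem (⟨x, hx⟩ : C k D)) p
  have hr' : frobenius (Frac k) p (toFrac k (r k D)) ∈ Crp k D p := hr
  have hF := hc (f_mem_C k D)
  have hFi := hc (f_inv_mem_C k D)
  have hG := hc (g_mem_C k D)
  have hGi := hc (g_inv_mem_C k D)
  have h0 : frobenius (Frac k) p (toFrac k (MvPolynomial.X 0)) ∈ Crp k D p := by
    rw [x0_eq k D]
    simp only [map_mul, map_add, map_pow] at *
    exact mul_mem hGi (add_mem (pow_mem hF _) (pow_mem hr' _))
  have h1 : frobenius (Frac k) p (toFrac k (MvPolynomial.X 1)) ∈ Crp k D p := by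
    rw [x1_eq k D, map_mul, map_sub, map_pow, map_pow]
    exact mul_mem (pow_mem hFi _) (sub_mem hr' (pow_mem h0 _))
  have h2 : frobenius (Frac k) p (toFrac k (MvPolynomial.X 2)) ∈ Crp k D p := by
    rw [x2_eq k D, map_mul, map_sub, map_mul, map_sum, map_pow, map_pow]
    refine mul_mem (pow_mem hFi _) (sub_mem hG (mul_mem (pow_mem h0 _) (sum_mem fun i _ => ?_)))
    rw [map_mul, map_pow, map_pow, map_mul, map_pow]
    exact mul_mem (pow_mem hr' _) (pow_mem (mul_mem (pow_mem hF _) h1) _)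
  fin_cases i
  · exact h0
  · exact h1
  · exact h2

/-- `xᵢ ^ p` as an element of `C[r ^ p]`. -/
noncomputable def xPow [CharP k p] (i : Fin 3) : Crp k D p :=
  ⟨toFrac k (MvPolynomial.X i) ^ p, x_pow_mem_Crp k D p i⟩

/-- `f` as an element of `C[r ^ p]`. -/
noncomputable def fCrp : Crp k D p :=
  ⟨toFrac k (f k D), (Crp k D p).algebraMap_mem (⟨_, f_mem_C k D⟩ : C k D)⟩

/-- `g` as an element of `C[r ^ p]`. -/
noncomputable def gCrp : Crp k D p :=
  ⟨toFrac k (g k D), (Crp k D p).algebraMap_mem (⟨_, g_mem_C k D⟩ : C k D)⟩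

open MvPolynomial in
/-- The ideal `(y ^ p - f, z ^ p - g)` of `k[x₁, x₂, x₃, y, z]`, where the five variables are
`X 0, X 1, X 2, X 3, X 4`. -/
noncomputable def relIdeal : Ideal (MvPolynomial (Fin 5) k) :=
  Ideal.span {X 3 ^ p - rename (Fin.castAdd 2) (f k D), X 4 ^ p - rename (Fin.castAdd 2) (g k D)}

end RankThree

/-!
An element `u(r)` of `C[r]` is fixed by `r ↦ r + f ^ l g h` if and only if it is a polynomial in the
Artin–Schreier expression `q`, so the invariants of `ε_h` are `k[x] ∩ C[q]`. The elements `x_i ^ p`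
satisfy over `(f ^ p, g ^ p, r ^ p)` the relations that define `x_i` over `(f, g, r)`. The
hypothesis on `h` makes `q - r ^ p` so divisible by `f` and `g` that these relations can be solved
over `(f ^ p, g ^ p, q)` as well, by polynomials `y_i ≡ x_i ^ p` modulo `f g`; by uniqueness
`y_i = ψ(x_i ^ p)`. Hence `k[y, f, g]` lies in the invariants and becomes equal to them after `f g`
is inverted, and what remains is that `f g b ∈ k[y, f, g]` implies `b ∈ k[y, f, g]`.

The algebras `k[y, f, g]` and `k[x ^ p, f, g]` have the same relations and the same reduction modulo
`f g`, so it is enough to prove this for `k[x ^ p, f, g]`. There the derivations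
`∂(f, ·) / ∂(x_i, x_j)` and `∂(g, ·) / ∂(x_i, x_j)`, which kill `p`-th powers, isolate the
coefficients of a polynomial of degree less than `p` in `f` and `g`. This is where `p ∤ t` and
`p ∤ m t - 1` enter. Finally, the relations `y ^ p - f` and `z ^ p - g` lie in the square of the
maximal ideal of the origin, so the cotangent space there has dimension five.
-/

namespace RankThree

open scoped Polynomial

section Derivations

variable {k A : Type*} [CommRing k] [CommRing A] [Algebra k A] {p : ℕ}

theorem derivation_eval₂ {R : Type*} [CommSemiring R] (d : Derivation k A A) (φ : R →+* A)
    (hφ : ∀ c, d (φ c) = 0) (P : R[X]) (b : A) :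
    d (P.eval₂ φ b) = P.derivative.eval₂ φ b * d b := by
  induction P using Polynomial.induction_on' with
  | add P Q hP hQ => simp only [Polynomial.eval₂_add, map_add, hP, hQ, add_mul]
  | monomial n c =>
    simp only [Polynomial.eval₂_monomial, Polynomial.derivative_monomial, Derivation.leibniz, hφ,
      Derivation.leibniz_pow, smul_eq_mul, nsmul_eq_mul, map_mul, map_natCast, mul_zero, add_zero]
    ring

theorem isUnit_natCast_of_lt [CharP A p] (hp : p.Prime) {n : ℕ} (hn0 : n ≠ 0) (hn : n < p) :
    IsUnit (n : A) :=
  (CharP.isUnit_natCast_iff hp).2 (Nat.not_dvd_of_pos_of_lt (Nat.pos_of_ne_zero hn0) hn)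

theorem dvd_coeff_of_dvd_eval₂ [CharP A p] (hp : p.Prime) {R : Type*} [CommSemiring R]
    (d : Derivation k A A) (φ : R →+* A) (hφ : ∀ c, d (φ c) = 0) {a b : A} (ha : d a = 0)
    (hb : ∀ w, a ∣ w * d b → a ∣ w) {P : R[X]} (hdeg : P.natDegree < p)
    (h : a ∣ P.eval₂ φ b) (i : ℕ) : a ∣ φ (P.coeff i) := by
  induction hn : P.natDegree using Nat.strong_induction_on generalizing P i with | h n ih =>
  subst hn
  have hsucc (j : ℕ) : a ∣ φ (P.coeff (j + 1)) := by
    rcases lt_or_ge P.natDegree (j + 1) with hj | hj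
    · simp [Polynomial.coeff_eq_zero_of_natDegree_lt hj]
    have hlt := Polynomial.natDegree_derivative_lt (p := P) (by omega)
    have hderiv : a ∣ P.derivative.eval₂ φ b := by
      obtain ⟨c, hc⟩ := h
      refine hb _ ⟨d c, ?_⟩
      rw [← derivation_eval₂ d φ hφ, hc, Derivation.leibniz, ha, smul_zero, add_zero, smul_eq_mul]
    have hcoeff := ih _ hlt (hlt.trans hdeg) hderiv j rfl
    rw [Polynomial.coeff_derivative, ← Nat.cast_succ, map_mul, map_natCast] at hcoeff
    exact (isUnit_natCast_of_lt hp j.succ_ne_zero (hj.trans_lt hdeg)).dvd_mul_right.1 hcoeff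
  rcases i with _ | i
  · have hX : a ∣ b * P.divX.eval₂ φ b := by
      rw [Polynomial.eval₂_eq_sum_range, Finset.mul_sum]
      exact Finset.dvd_sum fun j _ => ((P.coeff_divX ▸ hsucc j).mul_right _).mul_left _
    rw [← P.X_mul_divX_add, Polynomial.eval₂_add, Polynomial.eval₂_mul, Polynomial.eval₂_X,
      Polynomial.eval₂_C] at h
    exact (dvd_add_right hX).1 h
  · exact hsucc i

theorem pow_dvd_of_derivation [CharP A p] [IsDomain A] [DecompositionMonoid A] (hp : p.Prime)
    (d : Derivation k A A) {a s : A} (hs : d s = 0) (ha : a ∣ s) (hrel : IsRelPrime a (d a)) :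
    a ^ p ∣ s := by
  rcases eq_or_ne a 0 with rfl | ha0
  · rw [zero_dvd_iff.1 ha]; exact dvd_zero _
  suffices H : ∀ j ≤ p, a ^ j ∣ s from H p le_rfl
  intro j hj
  induction j with
  | zero => simp
  | succ j ih =>
    rcases eq_or_ne j 0 with rfl | hj0
    · simpa using ha
    obtain ⟨w, rfl⟩ := ih (by omega)
    have hw : a ^ (j - 1) * (j * (d a * w) + a * d w) = 0 := by
      rw [← hs, Derivation.leibniz, Derivation.leibniz_pow, ← Nat.sub_one_add_one hj0]
      simp only [Nat.add_sub_cancel, smul_eq_mul, nsmul_eq_mul]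
      ring
    have hjw : (j : A) * (d a * w) = a * -d w := by
      linear_combination (mul_eq_zero.1 hw).resolve_left (pow_ne_zero _ ha0)
    have haw : a ∣ w := hrel.dvd_of_dvd_mul_left <|
      (isUnit_natCast_of_lt hp hj0 (by omega)).dvd_mul_left.1 ⟨_, hjw⟩
    rw [pow_succ]
    exact mul_dvd_mul_left _ haw

theorem mem_sup_adjoin_singleton (E : Subalgebra k A) (y x : A) :
    x ∈ E ⊔ Algebra.adjoin k {y} ↔ ∃ P : E[X], Polynomial.aeval y P = x := by
  have h : E ⊔ Algebra.adjoin k {y} = (Algebra.adjoin E {y}).restrictScalars k := by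
    rw [← Algebra.adjoin_eq E, ← Algebra.adjoin_union, Algebra.adjoin_union_eq_adjoin_adjoin,
      Algebra.adjoin_eq]
  rw [h, Subalgebra.mem_restrictScalars, Algebra.adjoin_singleton_eq_range_aeval, AlgHom.mem_range]

theorem exists_aeval_natDegree_lt [Nontrivial A] {E : Subalgebra k A} {y x : A} {n : ℕ} (hn : n ≠ 0)
    (hy : y ^ n ∈ E) (hx : x ∈ E ⊔ Algebra.adjoin k {y}) :
    ∃ P : E[X], P.natDegree < n ∧ Polynomial.aeval y P = x := by
  obtain ⟨P, rfl⟩ := (mem_sup_adjoin_singleton E y x).1 hx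
  let M : E[X] := Polynomial.X ^ n - Polynomial.C ⟨y ^ n, hy⟩
  have hM : M.Monic := Polynomial.monic_X_pow_sub_C _ hn
  have hdeg : M.natDegree = n := Polynomial.natDegree_X_pow_sub_C
  refine ⟨P %ₘ M, ?_, Polynomial.aeval_modByMonic_eq_self_of_root ?_⟩
  · have hM1 : M ≠ 1 := fun h => hn (by rw [← hdeg, h, Polynomial.natDegree_one])
    exact hdeg ▸ Polynomial.natDegree_modByMonic_lt P hM hM1
  · simp [M]

theorem injective_comp_val_sup_adjoin {B : Type*} [CommRing B] [IsDomain B] [Algebra k B]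
    [CharP B p] (hp : p.Prime) (d : Derivation k B B) {E : Subalgebra k A} (φ : A →ₐ[k] B)
    (hφ : Function.Injective (φ.comp E.val)) (hE : ∀ x ∈ E, d (φ x) = 0) {y : A}
    (hy : y ^ p ∈ E) (hdy : d (φ y) ≠ 0) :
    Function.Injective (φ.comp (E ⊔ Algebra.adjoin k {y}).val) := by
  have : Nontrivial A := φ.toRingHom.domain_nontrivial
  rw [injective_iff_map_eq_zero] at hφ ⊢
  rintro ⟨x, hx⟩ hx0
  obtain ⟨P, hdeg, rfl⟩ := exists_aeval_natDegree_lt hp.ne_zero hy hx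
  have hroot : P.eval₂ (φ.comp E.val : E →+* B) (φ y) = 0 :=
    (Polynomial.hom_eval₂ P (algebraMap E A) (φ : A →+* B) y).symm.trans hx0
  suffices P = 0 by ext; simp [this]
  ext1 i
  refine hφ _ (zero_dvd_iff.1 ?_)
  refine dvd_coeff_of_dvd_eval₂ hp d (φ.comp E.val : E →+* B) (fun c => hE c c.2) (map_zero d)
    (fun w hw => ?_) hdeg (zero_dvd_iff.2 hroot) i
  simpa [hdy] using hw

theorem derivation_eq_zero_of_mem_sup_adjoin {B : Type*} [CommRing B] [Algebra k B]
    (d : Derivation k B B) {E : Subalgebra k A} (φ : A →ₐ[k] B) (hE : ∀ x ∈ E, d (φ x) = 0)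
    {y : A} (hy : d (φ y) = 0) {x : A} (hx : x ∈ E ⊔ Algebra.adjoin k {y}) : d (φ x) = 0 := by
  obtain ⟨P, rfl⟩ := (mem_sup_adjoin_singleton E y x).1 hx
  have heval : φ (Polynomial.aeval y P) = P.eval₂ (φ.comp E.val : E →+* B) (φ y) :=
    Polynomial.hom_eval₂ P (algebraMap E A) (φ : A →+* B) y
  rw [heval, derivation_eval₂ d _ fun c : E => hE c c.2, hy, mul_zero]

variable (k A) in
/-- The constants of all derivations of `A` over `k`. For a polynomial ring in characteristic `p`
these are the polynomials in the `p`-th powers of the variables. -/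
def derivationConstants : Subalgebra k A where
  carrier := {s | ∀ d : Derivation k A A, d s = 0}
  mul_mem' hs ht d := by rw [d.leibniz, hs d, ht d, smul_zero, smul_zero, add_zero]
  add_mem' hs ht d := by rw [d.map_add, hs d, ht d, add_zero]
  algebraMap_mem' c d := d.map_algebraMap c

theorem pow_mem_derivationConstants [CharP A p] (a : A) : a ^ p ∈ derivationConstants k A :=
  fun d => by simp [Derivation.leibniz_pow]

/-- A subalgebra `B` of `A` is saturated at `a` if it contains `b` whenever it contains `a * b`. -/
def IsSaturatedAt (B : Subalgebra k A) (a : A) : Prop :=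
  ∀ b, a * b ∈ B → b ∈ B

theorem IsSaturatedAt.mul {B : Subalgebra k A} {a b : A} (ha : IsSaturatedAt B a)
    (hb : IsSaturatedAt B b) : IsSaturatedAt B (a * b) :=
  fun c hc => hb c (ha _ (by rwa [← mul_assoc]))

theorem IsSaturatedAt.pow {B : Subalgebra k A} {a : A} (ha : IsSaturatedAt B a) (n : ℕ) :
    IsSaturatedAt B (a ^ n) := by
  induction n with
  | zero => exact fun b hb => by simpa using hb
  | succ n ih => exact pow_succ a n ▸ ih.mul ha

theorem isSaturatedAt_derivationConstants [IsDomain A] {a : A}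
    (ha : a ∈ derivationConstants k A) (ha0 : a ≠ 0) :
    IsSaturatedAt (derivationConstants k A) a := fun b hb d => by
  have := hb d
  rw [d.leibniz, ha d, smul_zero, add_zero, smul_eq_mul] at this
  exact (mul_eq_zero.1 this).resolve_left ha0

theorem IsSaturatedAt.range_of_dvd_sub [IsDomain A] {P : Type*} [CommRing P] [Algebra k P]
    {φ ψ : P →ₐ[k] A} {a : A} {z : P} (hsat : IsSaturatedAt φ.range a) (ha : a ≠ 0)
    (hφz : φ z = a) (hψz : ψ z = a) (hker : ∀ x, φ x = 0 → ψ x = 0)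
    (hdvd : ∀ x, a ∣ φ x - ψ x) : IsSaturatedAt ψ.range a := by
  rintro b ⟨x, hx⟩
  change ψ x = a * b at hx
  obtain ⟨c, hc⟩ : a ∣ φ x := (dvd_sub_left ⟨b, hx⟩).1 (hdvd x)
  obtain ⟨y, hy⟩ := hsat c ⟨x, hc⟩
  change φ y = c at hy
  have hxy := hker (x - z * y) (by rw [map_sub, map_mul, hφz, hy, hc, sub_self])
  rw [map_sub, map_mul, hψz, hx, ← mul_sub] at hxy
  exact ⟨y, (sub_eq_zero.1 ((mul_eq_zero.1 hxy).resolve_left ha)).symm⟩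

theorem exists_eq_pow_mul_of_mem_sup_adjoin [CharP A p] [IsDomain A] [DecompositionMonoid A]
    (hp : p.Prime) {a b w : A} (ha0 : a ≠ 0) (d d' : Derivation k A A) (ha : IsRelPrime a (d a))
    (hda : d' a = 0) (hdb : IsRelPrime a (d' b))
    (hw : w ∈ derivationConstants k A ⊔ Algebra.adjoin k {b}) (haw : a ∣ w) :
    ∃ v ∈ derivationConstants k A ⊔ Algebra.adjoin k {b}, w = a ^ p * v := by
  set K := derivationConstants k A
  obtain ⟨P, hdeg, rfl⟩ := exists_aeval_natDegree_lt hp.ne_zero (pow_mem_derivationConstants b) hw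
  have hcoeff (i : ℕ) : ∃ c ∈ K, (P.coeff i : A) = a ^ p * c := by
    have hai : a ∣ (P.coeff i : A) := dvd_coeff_of_dvd_eval₂ hp d' (algebraMap K A)
      (fun c => c.2 d') hda (fun _ => hdb.dvd_of_dvd_mul_right) hdeg haw i
    obtain ⟨c, hc⟩ := pow_dvd_of_derivation hp d ((P.coeff i).2 d) hai ha
    exact ⟨c, isSaturatedAt_derivationConstants (pow_mem_derivationConstants a)
      (pow_ne_zero p ha0) c (hc ▸ (P.coeff i).2), hc⟩
  choose c hcK hc using hcoeff
  refine ⟨∑ i ∈ Finset.range (P.natDegree + 1), c i * b ^ i, ?_, ?_⟩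
  · have hb := Algebra.self_mem_adjoin_singleton k b
    exact sum_mem fun i _ => mul_mem (Algebra.mem_sup_left (hcK i))
      (pow_mem (Algebra.mem_sup_right hb) i)
  · rw [Polynomial.aeval_eq_sum_range, Finset.mul_sum]
    refine Finset.sum_congr rfl fun i _ => ?_
    rw [Subalgebra.smul_def, smul_eq_mul, hc, mul_assoc]

theorem isSaturatedAt_sup_adjoin [CharP A p] [IsDomain A] [DecompositionMonoid A] (hp : p.Prime)
    {a b : A} (ha0 : a ≠ 0) (d d' : Derivation k A A) (ha : IsRelPrime a (d a)) (hda : d' a = 0)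
    (hdb : IsRelPrime a (d' b)) :
    IsSaturatedAt (derivationConstants k A ⊔ Algebra.adjoin k {b} ⊔ Algebra.adjoin k {a}) a := by
  intro u hu
  set L := derivationConstants k A ⊔ Algebra.adjoin k {b}
  have ha_mem : a ∈ L ⊔ Algebra.adjoin k {a} :=
    Algebra.mem_sup_right (Algebra.self_mem_adjoin_singleton k a)
  obtain ⟨P, hP⟩ := (mem_sup_adjoin_singleton L a _).1 hu
  rw [← P.X_mul_divX_add, map_add, map_mul, Polynomial.aeval_X, Polynomial.aeval_C] at hP
  set v := Polynomial.aeval a P.divX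
  have hv : v ∈ L ⊔ Algebra.adjoin k {a} := (mem_sup_adjoin_singleton L a v).2 ⟨_, rfl⟩
  obtain ⟨w, hw, hPw⟩ := exists_eq_pow_mul_of_mem_sup_adjoin hp ha0 d d' ha hda hdb (P.coeff 0).2
    ⟨u - v, by rw [mul_sub, ← hP, add_sub_cancel_left]; rfl⟩
  have huv : u = v + a ^ (p - 1) * w := by
    apply mul_left_cancel₀ ha0
    rw [← hP, mul_add, ← mul_assoc, mul_pow_sub_one hp.ne_zero, ← hPw]
    rfl
  rw [huv]
  exact add_mem hv (mul_mem (pow_mem ha_mem _) (Algebra.mem_sup_left hw))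

end Derivations

section MvPolynomial

variable {σ k : Type*} [CommRing k]

theorem dvd_of_mem_support_of_pderiv_eq_zero [IsDomain k] {p : ℕ} [CharP k p]
    {s : MvPolynomial σ k} {i : σ} (hs : MvPolynomial.pderiv i s = 0) {v : σ →₀ ℕ}
    (hv : v ∈ s.support) : p ∣ v i := by
  rcases eq_or_ne (v i) 0 with h0 | h0
  · simp [h0]
  have hle : Finsupp.single i 1 ≤ v := by rw [Finsupp.single_le_iff]; omega
  have hcoeff := congrArg (MvPolynomial.coeff (v - Finsupp.single i 1)) hs
  rw [MvPolynomial.coeff_pderiv, tsub_add_cancel_of_le hle, MvPolynomial.coeff_zero] at hcoeff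
  have hcast := (mul_eq_zero.1 hcoeff).resolve_left (MvPolynomial.mem_support_iff.1 hv)
  rwa [Finsupp.tsub_apply, Finsupp.single_eq_same, ← Nat.cast_succ, Nat.succ_eq_add_one,
    Nat.sub_one_add_one h0, CharP.cast_eq_zero_iff k p] at hcast

theorem derivationConstants_eq_range_expand [IsDomain k] (p : ℕ) [CharP k p] :
    derivationConstants k (MvPolynomial σ k) = (MvPolynomial.expand (R := k) p).range := by
  refine le_antisymm (fun s hs => ?_) ?_
  · rw [s.as_sum]
    refine sum_mem fun v hv => ⟨.monomial (v.mapRange (· / p) (by simp)) (s.coeff v), ?_⟩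
    have hpv : p • v.mapRange (· / p) (by simp) = v := by
      ext i
      simp [Nat.mul_div_cancel' (dvd_of_mem_support_of_pderiv_eq_zero (p := p) (hs _) hv)]
    change MvPolynomial.expand p _ = _
    rw [MvPolynomial.expand_monomial, hpv]
  · rw [MvPolynomial.expand, ← MvPolynomial.aeval_eq_bind₁,
      ← Algebra.adjoin_range_eq_range_aeval, Algebra.adjoin_le_iff]
    rintro _ ⟨i, rfl⟩
    exact pow_mem_derivationConstants _

theorem dvd_aeval_sub_aeval {A : Type*} [CommRing A] [Algebra k A] {a : A}
    {x y : σ → A} (h : ∀ i, a ∣ x i - y i) (P : MvPolynomial σ k) :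
    a ∣ MvPolynomial.aeval x P - MvPolynomial.aeval y P := by
  simp only [← Ideal.mem_span_singleton, ← Ideal.Quotient.mk_eq_mk_iff_sub_mem] at h ⊢
  simp only [MvPolynomial.aeval_def, MvPolynomial.hom_eval₂, h]

/-- The derivation `b ↦ ∂(a, b) / ∂(Xᵢ, Xⱼ)`. -/
noncomputable def jacobian (i j : σ) (a : MvPolynomial σ k) :
    Derivation k (MvPolynomial σ k) (MvPolynomial σ k) :=
  MvPolynomial.pderiv i a • MvPolynomial.pderiv j - MvPolynomial.pderiv j a • MvPolynomial.pderiv i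

theorem jacobian_apply (i j : σ) (a b : MvPolynomial σ k) :
    jacobian i j a b = MvPolynomial.pderiv i a * MvPolynomial.pderiv j b -
      MvPolynomial.pderiv j a * MvPolynomial.pderiv i b := rfl

theorem jacobian_self (i j : σ) (a : MvPolynomial σ k) : jacobian i j a a = 0 := by
  rw [jacobian_apply, mul_comm, sub_self]

theorem jacobian_swap (i j : σ) (a b : MvPolynomial σ k) :
    jacobian i j a b = -jacobian i j b a := by
  simp only [jacobian_apply]
  ring

/-- The linear part of a polynomial, as the vector of its partial derivatives at the origin. -/
noncomputable def linearPart : MvPolynomial σ k →ₗ[k] σ → k :=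
  LinearMap.pi fun i => MvPolynomial.lcoeff k 0 ∘ₗ (MvPolynomial.pderiv i).toLinearMap

theorem linearPart_apply (P : MvPolynomial σ k) (i : σ) :
    linearPart P i = MvPolynomial.constantCoeff (MvPolynomial.pderiv i P) := rfl

theorem linearPart_C (c : k) : linearPart (MvPolynomial.C c : MvPolynomial σ k) = 0 := by
  ext i
  simp [linearPart_apply]

theorem linearPart_X [DecidableEq σ] (i : σ) :
    linearPart (MvPolynomial.X i : MvPolynomial σ k) = Pi.single i 1 := by
  ext j
  rw [linearPart_apply, MvPolynomial.pderiv_X, Pi.single_comm, Pi.single_apply, Pi.single_apply]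
  split_ifs <;> simp

theorem linearPart_mul (P Q : MvPolynomial σ k) :
    linearPart (P * Q) = MvPolynomial.constantCoeff P • linearPart Q +
      MvPolynomial.constantCoeff Q • linearPart P := by
  ext i
  simp [linearPart_apply, Derivation.leibniz]

theorem linearPart_eq_zero_of_mem_sq {P : MvPolynomial σ k}
    (hP : P ∈ RingHom.ker (MvPolynomial.constantCoeff (σ := σ) (R := k)) ^ 2) :
    linearPart P = 0 := by
  rw [sq] at hP
  induction hP using Submodule.mul_induction_on' with
  | mem_mul_mem P hP Q hQ => rw [linearPart_mul, hP, hQ, zero_smul, zero_smul, add_zero]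
  | add P _ Q _ hP hQ => rw [map_add, hP, hQ, add_zero]

theorem linearPart_aeval_mem_span {τ : Type*} (P : τ → MvPolynomial σ k) (Q : MvPolynomial τ k) :
    linearPart (MvPolynomial.aeval P Q) ∈
      Submodule.span k (Set.range fun j => linearPart (P j)) := by
  induction Q using MvPolynomial.induction_on with
  | C c => rw [MvPolynomial.aeval_C, MvPolynomial.algebraMap_eq, linearPart_C]; exact zero_mem _
  | add Q Q' hQ hQ' => rw [map_add, map_add]; exact add_mem hQ hQ'
  | mul_X Q j hQ =>
    rw [map_mul, MvPolynomial.aeval_X, linearPart_mul]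
    exact add_mem (Submodule.smul_mem _ _ (Submodule.subset_span ⟨j, rfl⟩))
      (Submodule.smul_mem _ _ hQ)

theorem card_le_card_of_quotient_algEquiv {τ : Type*} [Nontrivial k] [Fintype σ] [Fintype τ]
    {I : Ideal (MvPolynomial σ k)}
    (hI : I ≤ RingHom.ker (MvPolynomial.constantCoeff (σ := σ) (R := k)) ^ 2)
    (e : (MvPolynomial σ k ⧸ I) ≃ₐ[k] MvPolynomial τ k) : Fintype.card σ ≤ Fintype.card τ := by
  classical
  choose P hP using fun j : τ => Ideal.Quotient.mk_surjective (e.symm (MvPolynomial.X j))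
  have hsection : (Ideal.Quotient.mkₐ k I).comp (MvPolynomial.aeval P) = e.symm.toAlgHom :=
    MvPolynomial.algHom_ext fun j => by simpa using hP j
  have hspan : Submodule.span k (Set.range fun j => linearPart (P j)) = ⊤ := by
    rw [eq_top_iff, ← (Pi.basisFun k σ).span_eq, Submodule.span_le]
    rintro _ ⟨i, rfl⟩
    have hX : Ideal.Quotient.mk I (MvPolynomial.aeval P (e (Ideal.Quotient.mk I (.X i)))) =
        Ideal.Quotient.mk I (.X i) :=
      (DFunLike.congr_fun hsection _).trans (e.symm_apply_apply _)
    have hlin := linearPart_eq_zero_of_mem_sq (hI ((Ideal.Quotient.mk_eq_mk_iff_sub_mem _ _).1 hX))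
    rw [map_sub, linearPart_X, sub_eq_zero] at hlin
    rw [Pi.basisFun_apply, ← hlin]
    exact linearPart_aeval_mem_span _ _
  have hcard := finrank_range_le_card (R := k) fun j => linearPart (P j)
  rwa [Set.finrank, hspan, finrank_top, Module.finrank_fintype_fun_eq_card] at hcard

end MvPolynomial

section ArtinSchreier

variable {A : Type*} [CommRing A]

theorem taylor_divByMonic_modByMonic [Nontrivial A] {a : A} {Q u : A[X]} (hQ : Q.Monic)
    (hQa : Polynomial.taylor a Q = Q) (hu : Polynomial.taylor a u = u) :
    Polynomial.taylor a (u /ₘ Q) = u /ₘ Q ∧ Polynomial.taylor a (u %ₘ Q) = u %ₘ Q := by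
  have hdiv : Polynomial.taylor a (u %ₘ Q) + Q * Polynomial.taylor a (u /ₘ Q) = u := by
    nth_rw 2 [← hQa]
    rw [← Polynomial.taylor_mul, ← map_add, Polynomial.modByMonic_add_div, hu]
  have hdeg : (Polynomial.taylor a (u %ₘ Q)).degree < Q.degree := by
    rw [Polynomial.degree_taylor]
    exact Polynomial.degree_modByMonic_lt u hQ
  obtain ⟨h₁, h₂⟩ := Polynomial.div_modByMonic_unique _ _ hQ ⟨hdiv, hdeg⟩
  exact ⟨h₁.symm, h₂.symm⟩

theorem eq_C_of_taylor_eq_self [IsDomain A] {p : ℕ} [CharP A p] {a : A} (ha : a ≠ 0)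
    {w : A[X]} (hdeg : w.natDegree < p) (hw : Polynomial.taylor a w = w) :
    w = Polynomial.C (w.eval 0) := by
  have heval (n : ℕ) : w.eval ((n : A) * a) = w.eval 0 := by
    induction n with
    | zero => simp
    | succ n ih => rw [← ih, Nat.cast_succ, add_one_mul, ← Polynomial.taylor_eval, hw]
  rw [← sub_eq_zero]
  refine Polynomial.eq_zero_of_natDegree_lt_card_of_eval_eq_zero _
    (f := fun i : Fin p => ((i : ℕ) : A) * a) (fun i j hij => ?_) (fun i => by simp [heval]) ?_
  · exact Fin.ext (CharP.natCast_injOn_Iio A p i.2 j.2 (mul_right_cancel₀ ha hij))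
  · rwa [Fintype.card_fin, Polynomial.natDegree_sub_C]

variable (p : ℕ)

/-- The Artin–Schreier polynomial, whose roots in characteristic `p` are the multiples of `a` by
the prime field. -/
noncomputable def artinSchreier (a : A) : A[X] :=
  Polynomial.X ^ p - Polynomial.C (a ^ (p - 1)) * Polynomial.X

variable [hp : Fact p.Prime]

theorem degree_C_mul_X_lt (a : A) :
    (Polynomial.C a * Polynomial.X).degree < (p : WithBot ℕ) :=
  (Polynomial.degree_C_mul_X_le a).trans_lt (mod_cast hp.out.one_lt)

theorem artinSchreier_monic (a : A) : (artinSchreier p a).Monic :=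
  Polynomial.monic_X_pow_sub (degree_C_mul_X_lt p _)

theorem natDegree_artinSchreier [Nontrivial A] (a : A) : (artinSchreier p a).natDegree = p := by
  have hlt : (Polynomial.C (a ^ (p - 1)) * Polynomial.X).degree <
      (Polynomial.X ^ p : A[X]).degree := by
    rw [Polynomial.degree_X_pow]
    exact degree_C_mul_X_lt p _
  have hdeg := Polynomial.degree_sub_eq_left_of_degree_lt hlt
  exact (Polynomial.natDegree_eq_of_degree_eq hdeg).trans (Polynomial.natDegree_X_pow p)

variable [CharP A p]

theorem taylor_artinSchreier (a : A) :
    Polynomial.taylor a (artinSchreier p a) = artinSchreier p a := by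
  have ha : Polynomial.C a ^ p = Polynomial.C (a ^ (p - 1)) * Polynomial.C a := by
    rw [Polynomial.C_pow, pow_sub_one_mul hp.out.ne_zero]
  simp only [artinSchreier, map_sub, Polynomial.taylor_mul, Polynomial.taylor_X_pow,
    Polynomial.taylor_X, Polynomial.taylor_C]
  rw [add_pow_char, ha]
  ring

theorem exists_eq_comp_artinSchreier [IsDomain A] {a : A} (ha : a ≠ 0) {u : A[X]}
    (hu : Polynomial.taylor a u = u) :
    ∃ v : A[X], u = v.comp (artinSchreier p a) := by
  induction hn : u.natDegree using Nat.strong_induction_on generalizing u with | h n ih =>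
  subst hn
  rcases lt_or_ge u.natDegree p with hlt | hge
  · exact ⟨_, by rw [Polynomial.C_comp]; exact eq_C_of_taylor_eq_self ha hlt hu⟩
  have hmonic := artinSchreier_monic p a
  have hdeg := natDegree_artinSchreier p a
  obtain ⟨hdiv, hmod⟩ := taylor_divByMonic_modByMonic hmonic (taylor_artinSchreier p a) hu
  have hlt : (u /ₘ artinSchreier p a).natDegree < u.natDegree := by
    rw [Polynomial.natDegree_divByMonic u hmonic, hdeg]
    have := hp.out.pos
    omega
  obtain ⟨v, hv⟩ := ih _ hlt hdiv rfl
  have hmod_lt : (u %ₘ artinSchreier p a).natDegree < p :=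
    (Polynomial.natDegree_modByMonic_lt u hmonic fun h => hp.out.ne_zero <| by
      rw [← hdeg, h, Polynomial.natDegree_one]).trans_eq hdeg
  have hconst := eq_C_of_taylor_eq_self ha hmod_lt hmod
  refine ⟨Polynomial.C ((u %ₘ artinSchreier p a).eval 0) + Polynomial.X * v, ?_⟩
  rw [Polynomial.add_comp, Polynomial.mul_comp, Polynomial.C_comp, Polynomial.X_comp, ← hv,
    ← hconst, Polynomial.modByMonic_add_div]

theorem taylor_eq_self_iff_exists_eq_comp_artinSchreier [IsDomain A] {a : A} (ha : a ≠ 0)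
    {u : A[X]} :
    Polynomial.taylor a u = u ↔ ∃ v : A[X], u = v.comp (artinSchreier p a) := by
  refine ⟨exists_eq_comp_artinSchreier p ha, ?_⟩
  rintro ⟨v, rfl⟩
  rw [Polynomial.taylor_apply, Polynomial.comp_assoc, ← Polynomial.taylor_apply,
    taylor_artinSchreier]

end ArtinSchreier

section Substitution

theorem subst_injective {A K B : Type*} [CommRing A] [CommRing K] [Algebra A K] [CommRing B]
    [Algebra A B] {s : K} (hs : Transcendental A s) (S : Subalgebra A K)
    (hS : S = Algebra.adjoin A {s}) {b : B} (hb : Transcendental A b) :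
    Function.Injective (subst hs S hS b) :=
  (transcendental_iff_injective.1 hb).comp <|
    (Polynomial.algEquivOfTranscendental A s hs).symm.injective.comp
      (Subalgebra.equivOfEq S _ hS).injective

end Substitution

section Action

variable (k : Type*) [Field k] (D : Params)

theorem coe_aeval_incl_r (u : (C k D)[X]) :
    (Polynomial.aeval (incl k D (r k D)) u : Frac k) = Polynomial.aeval (toFrac k (r k D)) u :=
  (Polynomial.aeval_algHom_apply (Cr k D).val (incl k D (r k D)) u).symm

theorem aeval_incl_r_surjective :
    Function.Surjective (Polynomial.aeval (R := C k D) (incl k D (r k D))) := by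
  rintro ⟨z, hz⟩
  obtain ⟨u, rfl⟩ := (Algebra.adjoin_singleton_eq_range_aeval (C k D) _).le hz
  exact ⟨u, Subtype.ext (coe_aeval_incl_r k D u)⟩

theorem aeval_incl_r_injective :
    Function.Injective (Polynomial.aeval (R := C k D) (incl k D (r k D))) := by
  intro u v huv
  apply transcendental_iff_injective.1 (transcendental_r k D)
  rw [← coe_aeval_incl_r, ← coe_aeval_incl_r, huv]

theorem eval_epsilonTilde_aeval (z : Cr k D) (u : (C k D)[X]) :
    (epsilonTilde k D (Polynomial.aeval (incl k D (r k D)) u)).eval z =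
      Polynomial.aeval (incl k D (r k D) + incl k D (f k D ^ D.l * g k D) * z) u := by
  rw [← Polynomial.aeval_algHom_apply, epsilonTilde_r, Polynomial.aeval_def, Polynomial.aeval_def,
    ← Polynomial.coe_evalRingHom, Polynomial.hom_eval₂]
  congr 1
  · exact RingHom.ext fun c => Polynomial.eval_C
  · simp only [Polynomial.coe_evalRingHom, Polynomial.eval_add, Polynomial.eval_mul,
      Polynomial.eval_C, Polynomial.eval_X]

theorem incl_epsilonAt (h b : Poly k) :
    incl k D (epsilonAt k D h b) = (epsilonTilde k D (incl k D b)).eval (incl k D h) := by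
  rw [← inclT_epsilon]
  change incl k D ((epsilon k D b).eval₂ _ h) =
    ((epsilon k D b).map (incl k D : Poly k →+* Cr k D)).eval _
  rw [Polynomial.eval_map]
  exact Polynomial.hom_eval₂ _ _ (incl k D : Poly k →+* Cr k D) h

theorem exists_incl_mul_algebraMap_eq_one :
    ∃ c : C k D, incl k D (f k D ^ D.l * g k D) * algebraMap (C k D) (Cr k D) c = 1 := by
  have hfg : toFrac k (f k D ^ D.l * g k D) ≠ 0 := by
    rw [map_mul, map_pow]
    exact mul_ne_zero (pow_ne_zero _ (tf_ne_zero k D)) (tg_ne_zero k D)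
  have hmem : (toFrac k (f k D ^ D.l * g k D))⁻¹ ∈ C k D := by
    rw [map_mul, map_pow, mul_inv, ← inv_pow]
    exact mul_mem (pow_mem (f_inv_mem_C k D) _) (g_inv_mem_C k D)
  exact ⟨⟨_, hmem⟩, Subtype.ext (mul_inv_cancel₀ hfg)⟩

theorem toFrac_mem_C_of_mem_epsilonInvariants {h : Poly k} (hinv : h ∈ epsilonInvariants k D) :
    toFrac k h ∈ C k D := by
  obtain ⟨u, hu⟩ := aeval_incl_r_surjective k D (incl k D h)
  obtain ⟨c, hc⟩ := exists_incl_mul_algebraMap_eq_one k D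
  have hfix : epsilonTilde k D (incl k D h) = Polynomial.C (incl k D h) := by
    rw [← inclT_epsilon, show epsilon k D h = Polynomial.C h from hinv, inclT_C]
  -- The substitution `T = -r / (f ^ l g)` sends `u(r)` to its constant term.
  have heval := eval_epsilonTilde_aeval k D
    (-(algebraMap (C k D) (Cr k D) c * incl k D (r k D))) u
  rw [hu, hfix, Polynomial.eval_C, mul_neg, ← mul_assoc, hc, one_mul, add_neg_cancel,
    ← Polynomial.coeff_zero_eq_aeval_zero'] at heval
  have hcoeff : toFrac k h = u.coeff 0 :=
    (congrArg (Cr k D).val heval).trans ((Cr k D).val.commutes (u.coeff 0))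
  rw [hcoeff]
  exact (u.coeff 0).2

/-- The element `f ^ l g h` of `C` by which `ε_h` translates `r`. -/
noncomputable def translation {h : Poly k} (hh : toFrac k h ∈ C k D) : C k D :=
  ⟨toFrac k (f k D ^ D.l * g k D * h), by
    rw [map_mul, map_mul, map_pow]
    exact mul_mem (mul_mem (pow_mem (f_mem_C k D) _) (g_mem_C k D)) hh⟩

theorem translation_ne_zero {h : Poly k} (hh : toFrac k h ∈ C k D) (h0 : h ≠ 0) :
    translation k D hh ≠ 0 := fun hzero =>
  mul_ne_zero (mul_ne_zero (pow_ne_zero _ (f_ne_zero k D)) (g_ne_zero k D)) h0 <|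
    (map_eq_zero_iff _ (toFrac_injective k)).1 (congrArg Subtype.val hzero)

theorem mem_invariants_iff_taylor_translation {h b : Poly k} (hh : toFrac k h ∈ C k D)
    {u : (C k D)[X]} (hu : Polynomial.aeval (incl k D (r k D)) u = incl k D b) :
    b ∈ invariants k (epsilonAt k D h) ↔ Polynomial.taylor (translation k D hh) u = u := by
  have htrans : incl k D (f k D ^ D.l * g k D) * incl k D h =
      algebraMap (C k D) (Cr k D) (translation k D hh) :=
    Subtype.ext (map_mul (toFrac k) _ h).symm
  have heval : Polynomial.aeval (incl k D (r k D)) (Polynomial.taylor (translation k D hh) u) =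
      incl k D (epsilonAt k D h b) := by
    rw [incl_epsilonAt, ← hu, eval_epsilonTilde_aeval, htrans, Polynomial.taylor_apply,
      Polynomial.aeval_comp, map_add, Polynomial.aeval_X, Polynomial.aeval_C]
  rw [← (aeval_incl_r_injective k D).eq_iff, heval, hu, (incl_injective k D).eq_iff]
  rfl

variable (p : ℕ)

theorem aeval_artinSchreier {h : Poly k} (hh : toFrac k h ∈ C k D) :
    Polynomial.aeval (toFrac k (r k D)) (artinSchreier p (translation k D hh)) =
      toFrac k (q k D p h) := by
  rw [artinSchreier, q, map_sub, map_sub, map_mul, map_mul, Polynomial.aeval_C, map_pow, map_pow,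
    map_pow, map_pow, Polynomial.aeval_X]
  rfl

variable [hp : Fact p.Prime]

theorem transcendental_q {h : Poly k} (hh : toFrac k h ∈ C k D) :
    Transcendental (C k D) (toFrac k (q k D p h)) := by
  rw [← aeval_artinSchreier k D p hh]
  refine (transcendental_r k D).aeval _ ?_ ?_
  · rw [natDegree_artinSchreier]; exact hp.out.ne_zero
  · rw [(artinSchreier_monic p _).leadingCoeff]; exact one_mem _

theorem psiFrac_injective {h : Poly k} (hh : toFrac k h ∈ C k D) :
    Function.Injective (psiFrac k D p h) :=
  Subtype.val_injective.comp <| subst_injective ((transcendental_r k D).pow hp.out.pos) _ rfl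
    fun halg => transcendental_q k D p hh (halg.algHom (Cq k D p h).val)

variable [CharP k p]

theorem mem_invariants_epsilonAt_iff {h b : Poly k} (hh : toFrac k h ∈ C k D) (h0 : h ≠ 0) :
    b ∈ invariants k (epsilonAt k D h) ↔ toFrac k b ∈ Cq k D p h := by
  have : CharP (C k D) p := charP_of_injective_algebraMap (algebraMap k (C k D)).injective p
  obtain ⟨u, hu⟩ := aeval_incl_r_surjective k D (incl k D b)
  have hcomp (v : (C k D)[X]) : Polynomial.aeval (toFrac k (q k D p h)) v =
      Polynomial.aeval (toFrac k (r k D)) (v.comp (artinSchreier p (translation k D hh))) := by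
    rw [Polynomial.aeval_comp, aeval_artinSchreier]
  have hb : Polynomial.aeval (toFrac k (r k D)) u = toFrac k b :=
    (coe_aeval_incl_r k D u).symm.trans (congrArg Subtype.val hu)
  rw [mem_invariants_iff_taylor_translation k D hh hu,
    taylor_eq_self_iff_exists_eq_comp_artinSchreier p (translation_ne_zero k D hh h0), Cq,
    Algebra.adjoin_singleton_eq_range_aeval, AlgHom.mem_range, ← hb]
  simp only [hcomp, (transcendental_iff_injective.1 (transcendental_r k D)).eq_iff, eq_comm]

end Action

section Coordinates

/-- The relations `x₁ g = f ^ (l t + 1) + r ^ t`, `f ^ l x₂ + x₁ ^ m = r` and `x₁ x₃ = f + x₂ ^ t`,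
read in an arbitrary ring, which recover coordinates `x` from elements `F`, `G`, `R` playing the
roles of `f`, `g`, `r`. -/
structure CoordRel (D : Params) {A : Type*} [CommRing A] (F G R : A) (x : Fin 3 → A) : Prop where
  mul_zero_eq : G * x 0 = F ^ (D.l * D.t + 1) + R ^ D.t
  mul_one_add : F ^ D.l * x 1 + x 0 ^ D.m = R
  zero_mul_two : x 0 * x 2 = F + x 1 ^ D.t

namespace CoordRel

variable {D : Params} {A B : Type*} [CommRing A] [CommRing B] {F G R : A} {x y : Fin 3 → A}

theorem map (h : CoordRel D F G R x) (φ : A →+* B) :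
    CoordRel D (φ F) (φ G) (φ R) fun i => φ (x i) where
  mul_zero_eq := by simpa only [map_mul, map_add, map_pow] using congrArg φ h.mul_zero_eq
  mul_one_add := by simpa only [map_mul, map_add, map_pow] using congrArg φ h.mul_one_add
  zero_mul_two := by simpa only [map_mul, map_add, map_pow] using congrArg φ h.zero_mul_two

theorem eq [IsDomain A] (hx : CoordRel D F G R x) (hy : CoordRel D F G R y) (hF : F ≠ 0)
    (hG : G ≠ 0) (hx0 : x 0 ≠ 0) : x = y := by
  have h0 : x 0 = y 0 := mul_left_cancel₀ hG (hx.mul_zero_eq.trans hy.mul_zero_eq.symm)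
  have h1 : x 1 = y 1 := by
    refine mul_left_cancel₀ (pow_ne_zero D.l hF) (add_right_cancel (b := x 0 ^ D.m) ?_)
    rw [hx.mul_one_add, h0, hy.mul_one_add]
  have h2 : x 2 = y 2 := mul_left_cancel₀ hx0 <| by
    rw [hx.zero_mul_two, h0, h1, hy.zero_mul_two]
  funext i
  fin_cases i
  exacts [h0, h1, h2]

theorem dvd_add_pow [DecompositionMonoid A] {x₀ x₁ : A}
    (h₀ : G * x₀ = F ^ (D.l * D.t + 1) + R ^ D.t) (h₁ : F ^ D.l * x₁ + x₀ ^ D.m = R)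
    (hrel : IsRelPrime x₀ F) : x₀ ∣ F + x₁ ^ D.t := by
  have hR : x₀ ∣ R ^ D.t - (F ^ D.l * x₁) ^ D.t := by
    refine dvd_trans ?_ (sub_dvd_pow_sub_pow _ _ _)
    rw [← h₁, add_sub_cancel_left]
    exact dvd_pow_self _ (Nat.one_le_iff_ne_zero.1 D.one_le_m)
  refine (hrel.pow_right (n := D.l * D.t)).dvd_of_dvd_mul_left ?_
  have hsum : F ^ (D.l * D.t) * (F + x₁ ^ D.t) =
      G * x₀ - (R ^ D.t - (F ^ D.l * x₁) ^ D.t) := by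
    rw [h₀, mul_pow, ← pow_mul]
    ring
  rw [hsum]
  exact dvd_sub (dvd_mul_left _ _) hR

theorem exists_perturb [DecompositionMonoid A] (h : CoordRel D F G R x) {c w : A}
    (hF : IsRelPrime (x 0) F) (hc : IsRelPrime (x 0) c) :
    ∃ y, CoordRel D F G (R + c * F ^ D.l * G * w) y ∧ ∀ i, c ∣ y i - x i := by
  obtain ⟨S, hS⟩ := sub_dvd_pow_sub_pow (R + c * F ^ D.l * G * w) R D.t
  obtain ⟨S', hS'⟩ := sub_dvd_pow_sub_pow (x 0 + c * (F ^ D.l * w * S)) (x 0) D.m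
  rw [add_sub_cancel_left] at hS hS'
  set y₀ := x 0 + c * (F ^ D.l * w * S)
  set y₁ := x 1 + c * (G * w - w * S * S')
  have h₀ : G * y₀ = F ^ (D.l * D.t + 1) + (R + c * F ^ D.l * G * w) ^ D.t := by
    linear_combination h.mul_zero_eq - hS
  have h₁ : F ^ D.l * y₁ + y₀ ^ D.m = R + c * F ^ D.l * G * w := by
    linear_combination h.mul_one_add + hS'
  have hyF : IsRelPrime y₀ F := by
    obtain ⟨e, he⟩ : F ∣ c * (F ^ D.l * w * S) :=
      (((dvd_pow_self F (Nat.one_le_iff_ne_zero.1 D.one_le_l)).mul_right w).mul_right S).mul_left c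
    simpa only [y₀, he] using hF.add_mul_left_left e
  have hyc : IsRelPrime c y₀ := (hc.add_mul_left_left _).symm
  obtain ⟨y₂, h₂⟩ := dvd_add_pow h₀ h₁ hyF
  have hd₀ : c ∣ y₀ - x 0 := ⟨F ^ D.l * w * S, add_sub_cancel_left _ _⟩
  have hd₁ : c ∣ y₁ - x 1 := ⟨G * w - w * S * S', add_sub_cancel_left _ _⟩
  have hd₂ : c ∣ y₂ - x 2 := by
    refine hyc.dvd_of_dvd_mul_left ?_
    have hsub : y₀ * (y₂ - x 2) = y₁ ^ D.t - x 1 ^ D.t - (y₀ - x 0) * x 2 := by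
      linear_combination -h₂ - h.zero_mul_two
    rw [hsub]
    exact dvd_sub (hd₁.trans (sub_dvd_pow_sub_pow _ _ _)) (hd₀.mul_right _)
  refine ⟨![y₀, y₁, y₂], ⟨h₀, h₁, h₂.symm⟩, fun i => ?_⟩
  fin_cases i
  exacts [hd₀, hd₁, hd₂]

end CoordRel

end Coordinates

section Presentation

variable {k A B : Type*} [CommRing k] [CommRing A] [Algebra k A] [CommRing B] [Algebra k B]

/-- The homomorphism `k[x₁, x₂, x₃, y, z] → A` with `xᵢ ↦ x i`, `y ↦ a` and `z ↦ b`. -/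
noncomputable def fiveHom (x : Fin 3 → A) (a b : A) : MvPolynomial (Fin 5) k →ₐ[k] A :=
  MvPolynomial.aeval ![x 0, x 1, x 2, a, b]

theorem comp_fiveHom (φ : A →ₐ[k] B) (x : Fin 3 → A) (a b : A) :
    φ.comp (fiveHom x a b) = fiveHom (fun i => φ (x i)) (φ a) (φ b) := by
  refine MvPolynomial.algHom_ext fun i => ?_
  fin_cases i <;> simp [fiveHom]

theorem eq_fiveHom (φ : MvPolynomial (Fin 5) k →ₐ[k] A) :
    φ = fiveHom (fun i => φ (MvPolynomial.X (Fin.castAdd 2 i))) (φ (MvPolynomial.X 3))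
      (φ (MvPolynomial.X 4)) := by
  refine MvPolynomial.algHom_ext fun i => ?_
  fin_cases i <;> simp [fiveHom]

theorem fiveHom_rename (x : Fin 3 → A) (a b : A) (P : MvPolynomial (Fin 3) k) :
    fiveHom x a b (MvPolynomial.rename (Fin.castAdd 2) P) = MvPolynomial.aeval x P := by
  rw [fiveHom, MvPolynomial.aeval_rename]
  congr 2
  funext i
  fin_cases i <;> rfl

theorem range_fiveHom (x : Fin 3 → A) (a b : A) :
    (fiveHom x a b : MvPolynomial (Fin 5) k →ₐ[k] A).range =
      Algebra.adjoin k {x 0, x 1, x 2, a, b} := by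
  rw [fiveHom, ← Algebra.adjoin_range_eq_range_aeval]
  simp only [Matrix.range_cons, Matrix.range_empty, Set.union_empty, Set.singleton_union]

theorem range_fiveHom_eq_sup (x : Fin 3 → A) (a b : A) :
    (fiveHom x a b : MvPolynomial (Fin 5) k →ₐ[k] A).range =
      (MvPolynomial.aeval x : MvPolynomial (Fin 3) k →ₐ[k] A).range ⊔ Algebra.adjoin k {a} ⊔
        Algebra.adjoin k {b} := by
  have hx : Set.range x = {x 0, x 1, x 2} := by
    ext; simp [Fin.exists_fin_succ, eq_comm]
  rw [range_fiveHom, ← Algebra.adjoin_range_eq_range_aeval, hx, ← Algebra.adjoin_union,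
    ← Algebra.adjoin_union]
  congr 1
  ext
  simp only [Set.mem_union, Set.mem_insert_iff, Set.mem_singleton_iff]
  tauto

end Presentation

section Polynomials

variable (k : Type*) [Field k] (D : Params)

theorem isRelPrime_X_f : IsRelPrime (MvPolynomial.X 0) (f k D) := by
  refine MvPolynomial.X_prime.irreducible.isRelPrime_iff_not_dvd.2 ?_
  rintro ⟨c, hc⟩
  have := congrArg (MvPolynomial.eval ![0, 1, 0]) hc
  simp [f] at this

theorem isRelPrime_X_g : IsRelPrime (MvPolynomial.X 0) (g k D) := by
  refine MvPolynomial.X_prime.irreducible.isRelPrime_iff_not_dvd.2 ?_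
  rintro ⟨c, hc⟩
  have h0 := congrArg (MvPolynomial.eval ![0, 1, 0]) hc
  have h1 := congrArg (MvPolynomial.eval ![0, 1, 1]) hc
  simp only [g, f, r, map_add, map_mul, map_pow, map_sub, map_sum, MvPolynomial.eval_X,
    Matrix.cons_val_zero, Matrix.cons_val_one, Matrix.cons_val, zero_mul, one_pow, zero_sub,
    mul_zero, mul_one, zero_add] at h0 h1
  have h2 : (-1 : k) ^ (D.l * D.t) = 0 := by linear_combination h1 - h0
  simp at h2

theorem isRelPrime_f_r : IsRelPrime (f k D) (r k D) := by
  have hX : IsRelPrime (f k D) (MvPolynomial.X 0 ^ D.m) := (isRelPrime_X_f k D).symm.pow_right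
  obtain ⟨c, hc⟩ : f k D ∣ f k D ^ D.l * MvPolynomial.X 1 :=
    (dvd_pow_self _ (Nat.one_le_iff_ne_zero.1 D.one_le_l)).mul_right _
  rw [r, hc, add_comm]
  exact hX.add_mul_left_right c

theorem isRelPrime_f_g : IsRelPrime (f k D) (g k D) := by
  have hr : IsRelPrime (f k D) (r k D ^ D.t) := (isRelPrime_f_r k D).pow_right
  have hX := X_mul_g k D
  rw [add_comm, pow_succ'] at hX
  have hXg : IsRelPrime (f k D) (MvPolynomial.X 0 * g k D) := by
    rw [hX]
    exact hr.add_mul_left_right _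
  exact hXg.of_mul_right_right

theorem isRelPrime_g_r : IsRelPrime (g k D) (r k D) := by
  intro d hg hr
  have hf : d ∣ f k D ^ (D.l * D.t + 1) := by
    rw [← dvd_add_left (hr.trans (dvd_pow_self _ (Nat.ne_zero_of_lt D.two_le_t))), ← X_mul_g]
    exact hg.mul_left _
  exact (isRelPrime_f_g k D).pow_left hf hg

theorem r_ne_zero : r k D ≠ 0 := by
  intro h
  have ht : D.t ≠ 0 := Nat.ne_zero_of_lt D.two_le_t
  have hf : IsUnit (f k D) := isRelPrime_zero_right.1 (h ▸ isRelPrime_f_r k D)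
  simpa [f, ht] using hf.map (MvPolynomial.eval ![0, 0, 0])

theorem derivation_r {d : Derivation k (Poly k) (Poly k)} (hf : d (f k D) = 0) :
    d (r k D) = f k D ^ D.l * d (MvPolynomial.X 1) +
      (D.m : Poly k) * MvPolynomial.X 0 ^ (D.m - 1) * d (MvPolynomial.X 0) := by
  simp only [r, map_add, Derivation.leibniz, Derivation.leibniz_pow, hf, smul_eq_mul, nsmul_eq_mul,
    mul_zero, add_zero, mul_assoc]

theorem derivation_g {d : Derivation k (Poly k) (Poly k)} (hf : d (f k D) = 0) :
    MvPolynomial.X 0 * d (g k D) + g k D * d (MvPolynomial.X 0) =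
      (D.t : Poly k) * r k D ^ (D.t - 1) * d (r k D) := by
  simpa only [map_add, Derivation.leibniz, Derivation.leibniz_pow, hf, smul_eq_mul, nsmul_eq_mul,
    mul_zero, zero_add, mul_assoc] using congrArg d (X_mul_g k D)

theorem pderiv_two_f : MvPolynomial.pderiv 2 (f k D) = MvPolynomial.X 0 := by
  simp [f, MvPolynomial.pderiv_X]

theorem X_mul_jacobian_two_zero_f_g :
    MvPolynomial.X 0 * jacobian 2 0 (f k D) (g k D) =
      ((D.m : Poly k) * (D.t : Poly k) - 1) * r k D ^ D.t +
        f k D * (-((D.m : Poly k) * (D.t : Poly k) * r k D ^ (D.t - 1) *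
          (f k D ^ (D.l - 1) * MvPolynomial.X 1)) - f k D ^ (D.l * D.t)) := by
  have hf := jacobian_self (k := k) 2 0 (f k D)
  have hX0 : jacobian 2 0 (f k D) (MvPolynomial.X 0) = MvPolynomial.X 0 := by
    simp [jacobian_apply, pderiv_two_f, MvPolynomial.pderiv_X]
  have hX1 : jacobian 2 0 (f k D) (MvPolynomial.X 1) = 0 := by
    simp [jacobian_apply, MvPolynomial.pderiv_X]
  have hg := derivation_g k D hf
  rw [derivation_r k D hf, hX0, hX1, mul_zero, zero_add, mul_assoc (D.m : Poly k),
    pow_sub_one_mul (Nat.one_le_iff_ne_zero.1 D.one_le_m)] at hg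
  have hr : r k D = f k D ^ D.l * MvPolynomial.X 1 + MvPolynomial.X 0 ^ D.m := rfl
  have hl := pow_sub_one_mul (Nat.one_le_iff_ne_zero.1 D.one_le_l) (f k D)
  have ht := pow_sub_one_mul (Nat.ne_zero_of_lt D.two_le_t) (r k D)
  linear_combination hg - X_mul_g k D - (D.m : Poly k) * (D.t : Poly k) * r k D ^ (D.t - 1) * hr +
    (D.m : Poly k) * (D.t : Poly k) * r k D ^ (D.t - 1) * MvPolynomial.X 1 * hl +
    (D.m : Poly k) * (D.t : Poly k) * ht

theorem jacobian_two_one_f_g :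
    jacobian 2 1 (f k D) (g k D) = (D.t : Poly k) * r k D ^ (D.t - 1) * f k D ^ D.l := by
  have hf := jacobian_self (k := k) 2 1 (f k D)
  have hX0 : jacobian 2 1 (f k D) (MvPolynomial.X 0) = 0 := by
    simp [jacobian_apply, MvPolynomial.pderiv_X]
  have hX1 : jacobian 2 1 (f k D) (MvPolynomial.X 1) = MvPolynomial.X 0 := by
    simp [jacobian_apply, pderiv_two_f, MvPolynomial.pderiv_X]
  have hg := derivation_g k D hf
  rw [derivation_r k D hf, hX0, hX1] at hg
  apply mul_left_cancel₀ (MvPolynomial.X_ne_zero (R := k) (0 : Fin 3))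
  linear_combination hg

variable {p : ℕ} [CharP k p]

theorem isUnit_natCast_of_not_dvd {n : ℕ} (hn : ¬ p ∣ n) :
    IsUnit (n : Poly k) := by
  have hk : IsUnit (n : k) := IsUnit.mk0 _ (mt (CharP.cast_eq_zero_iff k p n).1 hn)
  simpa only [map_natCast] using hk.map (algebraMap k (Poly k))

theorem isRelPrime_f_jacobian_two_zero_f_g (hpmt : ¬ p ∣ D.m * D.t - 1) :
    IsRelPrime (f k D) (jacobian 2 0 (f k D) (g k D)) := by
  have hunit : IsUnit ((D.m : Poly k) * (D.t : Poly k) - 1) := by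
    simpa only [Nat.cast_sub ((by norm_num : 1 ≤ 3).trans D.three_le_mt), Nat.cast_mul,
      Nat.cast_one] using isUnit_natCast_of_not_dvd k hpmt
  have hrel : IsRelPrime (f k D) (MvPolynomial.X 0 * jacobian 2 0 (f k D) (g k D)) := by
    rw [X_mul_jacobian_two_zero_f_g]
    exact (hunit.isRelPrime_right.mul_right (isRelPrime_f_r k D).pow_right).add_mul_left_right _
  exact hrel.of_mul_right_right

theorem isRelPrime_g_jacobian_two_one_f_g (hpt : ¬ p ∣ D.t) :
    IsRelPrime (g k D) (jacobian 2 1 (f k D) (g k D)) := by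
  rw [jacobian_two_one_f_g]
  exact ((isUnit_natCast_of_not_dvd k hpt).isRelPrime_right.mul_right
    (isRelPrime_g_r k D).pow_right).mul_right (isRelPrime_f_g k D).symm.pow_right

theorem jacobian_two_one_f_g_ne_zero (hpt : ¬ p ∣ D.t) :
    jacobian 2 1 (f k D) (g k D) ≠ 0 := by
  rw [jacobian_two_one_f_g]
  exact mul_ne_zero (mul_ne_zero (isUnit_natCast_of_not_dvd k hpt).ne_zero
    (pow_ne_zero _ (r_ne_zero k D))) (pow_ne_zero _ (f_ne_zero k D))

theorem coordRel_X : CoordRel D (f k D) (g k D) (r k D) (MvPolynomial.X : Fin 3 → Poly k) where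
  mul_zero_eq := by rw [mul_comm, X_mul_g]
  mul_one_add := rfl
  zero_mul_two := by rw [f]; ring

end Polynomials

section FrobeniusInvariant

variable {σ k : Type*} [CommRing k] {p : ℕ} [hp : Fact p.Prime] [CharP k p]

theorem expand_eq_pow_of_map_frobenius_eq {a : MvPolynomial σ k}
    (ha : MvPolynomial.map (frobenius k p) a = a) : MvPolynomial.expand p a = a ^ p := by
  rw [← MvPolynomial.map_frobenius_expand, MvPolynomial.map_expand, ha]

end FrobeniusInvariant

section PowerSubalgebra

variable (k : Type*) [Field k] (D : Params) (p : ℕ) [CharP k p]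

theorem range_fiveHom_X_pow :
    (fiveHom (k := k) (fun i => (MvPolynomial.X i : Poly k) ^ p) (f k D) (g k D)).range =
      derivationConstants k (Poly k) ⊔ Algebra.adjoin k {f k D} ⊔
        Algebra.adjoin k {g k D} := by
  rw [range_fiveHom_eq_sup, derivationConstants_eq_range_expand p]
  rfl

variable [hp : Fact p.Prime]

theorem expand_f : MvPolynomial.expand p (f k D) = f k D ^ p :=
  expand_eq_pow_of_map_frobenius_eq (by simp [f])

theorem expand_g : MvPolynomial.expand p (g k D) = g k D ^ p :=
  expand_eq_pow_of_map_frobenius_eq (by simp [f, g, r])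

theorem coordRel_X_pow : CoordRel D (f k D ^ p) (g k D ^ p) (r k D ^ p)
    fun i => (MvPolynomial.X i : Poly k) ^ p :=
  (coordRel_X k D).map (frobenius (Poly k) p)

theorem isSaturatedAt_range_fiveHom_X_pow (hpt : ¬ p ∣ D.t) (hpmt : ¬ p ∣ D.m * D.t - 1) :
    IsSaturatedAt (fiveHom (k := k) (fun i => (MvPolynomial.X i : Poly k) ^ p) (f k D)
      (g k D)).range (f k D * g k D) := by
  rw [range_fiveHom_X_pow]
  have hX : IsRelPrime (f k D) (MvPolynomial.pderiv 2 (f k D)) := by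
    rw [pderiv_two_f]
    exact (isRelPrime_X_f k D).symm
  have hjac := isRelPrime_g_jacobian_two_one_f_g k D hpt
  have hjac' : IsRelPrime (g k D) (jacobian 2 1 (g k D) (f k D)) := by
    rw [jacobian_swap]
    exact hjac.neg_right
  have hf : IsSaturatedAt (derivationConstants k (Poly k) ⊔ Algebra.adjoin k {g k D} ⊔
      Algebra.adjoin k {f k D}) (f k D) :=
    isSaturatedAt_sup_adjoin hp.out (f_ne_zero k D) (MvPolynomial.pderiv 2)
      (jacobian 2 0 (f k D)) hX (jacobian_self _ _ _)
      (isRelPrime_f_jacobian_two_zero_f_g k D hpmt)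
  have hg : IsSaturatedAt (derivationConstants k (Poly k) ⊔ Algebra.adjoin k {f k D} ⊔
      Algebra.adjoin k {g k D}) (g k D) :=
    isSaturatedAt_sup_adjoin hp.out (g_ne_zero k D) (jacobian 2 1 (f k D))
      (jacobian 2 1 (g k D)) hjac (jacobian_self _ _ _) hjac'
  rw [sup_right_comm] at hf
  exact hf.mul hg

end PowerSubalgebra

section Kernel

variable {k : Type*} [Field k] {D : Params} {p : ℕ} [hp : Fact p.Prime] [CharP k p]

theorem injective_of_comp_eq_expand {A : Type*} [CommRing A] [Algebra k A] (hpt : ¬ p ∣ D.t)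
    (φ : A →ₐ[k] Poly k) (ι : Poly k →ₐ[k] A) (hι : φ.comp ι = MvPolynomial.expand p)
    {y z : A} (hφy : φ y = f k D) (hφz : φ z = g k D) (hy : y ^ p ∈ ι.range)
    (hz : z ^ p ∈ ι.range) (htop : ι.range ⊔ Algebra.adjoin k {z} ⊔ Algebra.adjoin k {y} = ⊤) :
    Function.Injective φ := by
  have hφι (a : Poly k) : φ (ι a) = MvPolynomial.expand p a := DFunLike.congr_fun hι a
  have hconst (d : Derivation k (Poly k) (Poly k)) : ∀ x ∈ ι.range, d (φ x) = 0 := by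
    rintro _ ⟨a, rfl⟩
    have ha : φ (ι a) ∈ derivationConstants k (Poly k) := by
      rw [derivationConstants_eq_range_expand p]
      exact ⟨a, (hφι a).symm⟩
    exact ha d
  have hinj : Function.Injective (φ.comp ι.range.val) := by
    rintro ⟨_, a, rfl⟩ ⟨_, b, rfl⟩ hab
    have hexp := (hφι a).symm.trans (hab.trans (hφι b))
    exact Subtype.ext (congrArg ι (MvPolynomial.expand_injective hp.out.pos hexp))
  have hne := jacobian_two_one_f_g_ne_zero k D hpt
  have hinj_z := injective_comp_val_sup_adjoin hp.out (jacobian 2 1 (f k D)) φ hinj (hconst _) hz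
    (by rwa [hφz])
  have hinj_y := injective_comp_val_sup_adjoin hp.out (jacobian 2 1 (g k D)) φ hinj_z
    (fun x => derivation_eq_zero_of_mem_sup_adjoin _ φ (hconst _) (by rw [hφz, jacobian_self]))
    (Algebra.mem_sup_left hy) (by rwa [hφy, jacobian_swap, neg_ne_zero])
  intro a b hab
  have hmem (c : A) : c ∈ ι.range ⊔ Algebra.adjoin k {z} ⊔ Algebra.adjoin k {y} :=
    htop ▸ Algebra.mem_top
  exact congrArg Subtype.val (@hinj_y ⟨a, hmem a⟩ ⟨b, hmem b⟩ hab)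

variable (k D p)

theorem relIdeal_le_ker_fiveHom_X_pow : relIdeal k D p ≤
    RingHom.ker (fiveHom (k := k) (fun i => (MvPolynomial.X i : Poly k) ^ p) (f k D) (g k D)) := by
  have hrename (a : Poly k) : fiveHom (fun i => (MvPolynomial.X i : Poly k) ^ p) (f k D) (g k D)
      (MvPolynomial.rename (Fin.castAdd 2) a) = MvPolynomial.expand p a := fiveHom_rename _ _ _ a
  rw [relIdeal, Ideal.span_le, Set.pair_subset_iff]
  simp only [SetLike.mem_coe, RingHom.mem_ker, map_sub, map_pow, hrename, expand_f, expand_g]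
  simp [fiveHom]

theorem ker_fiveHom_X_pow (hpt : ¬ p ∣ D.t) :
    RingHom.ker (fiveHom (k := k) (fun i => (MvPolynomial.X i : Poly k) ^ p) (f k D) (g k D)) =
      relIdeal k D p := by
  have hle := relIdeal_le_ker_fiveHom_X_pow k D p
  set Φ := fiveHom (k := k) (fun i => (MvPolynomial.X i : Poly k) ^ p) (f k D) (g k D)
  set mk := Ideal.Quotient.mkₐ k (relIdeal k D p)
  set φ := Ideal.Quotient.liftₐ (relIdeal k D p) Φ hle
  set ι : Poly k →ₐ[k] _ := MvPolynomial.aeval fun i => mk (MvPolynomial.X (Fin.castAdd 2 i))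
  have hmk (a : Poly k) : ι a = mk (MvPolynomial.rename (Fin.castAdd 2) a) := by
    rw [eq_fiveHom mk, fiveHom_rename]
  have hι : φ.comp ι = MvPolynomial.expand p := AlgHom.ext fun a =>
    (congrArg φ (hmk a)).trans (fiveHom_rename (fun i => (MvPolynomial.X i : Poly k) ^ p) _ _ a)
  have htop : ι.range ⊔ Algebra.adjoin k {mk (MvPolynomial.X 4)} ⊔
      Algebra.adjoin k {mk (MvPolynomial.X 3)} = ⊤ := by
    rw [sup_right_comm, ← range_fiveHom_eq_sup, ← eq_fiveHom, AlgHom.range_eq_top]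
    exact Ideal.Quotient.mkₐ_surjective k _
  have hy : mk (MvPolynomial.X 3 ^ p) = mk (MvPolynomial.rename (Fin.castAdd 2) (f k D)) :=
    Ideal.Quotient.eq.2 (Ideal.subset_span (Set.mem_insert _ _))
  have hz : mk (MvPolynomial.X 4 ^ p) = mk (MvPolynomial.rename (Fin.castAdd 2) (g k D)) :=
    Ideal.Quotient.eq.2 (Ideal.subset_span (Set.mem_insert_of_mem _ rfl))
  have hinj : Function.Injective φ :=
    injective_of_comp_eq_expand hpt φ ι hι (y := mk (MvPolynomial.X 3))
      (z := mk (MvPolynomial.X 4)) (MvPolynomial.aeval_X _ _) (MvPolynomial.aeval_X _ _)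
      ⟨f k D, by rw [← map_pow, hy]; exact hmk _⟩ ⟨g k D, by rw [← map_pow, hz]; exact hmk _⟩ htop
  refine le_antisymm (fun P hP => Ideal.Quotient.eq_zero_iff_mem.1 (hinj ?_)) hle
  exact hP.trans (map_zero φ).symm

end Kernel

section Invariants

variable (k : Type*) [Field k] (D : Params) (p : ℕ)

theorem exists_pow_mul_mem_of_mem_Cq {B : Subalgebra k (Frac k)} {h : Poly k}
    (hf : toFrac k (f k D) ∈ B) (hg : toFrac k (g k D) ∈ B) (hq : toFrac k (q k D p h) ∈ B)
    {z : Frac k} (hz : z ∈ Cq k D p h) :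
    ∃ n, (toFrac k (f k D) * toFrac k (g k D)) ^ n * z ∈ B := by
  have hf0 := tf_ne_zero k D
  have hg0 := tg_ne_zero k D
  have hadjoin : z ∈ Algebra.adjoin k (({toFrac k (f k D), (toFrac k (f k D))⁻¹,
      toFrac k (g k D), (toFrac k (g k D))⁻¹} : Set (Frac k)) ∪ {toFrac k (q k D p h)}) := by
    rw [Algebra.adjoin_union_eq_adjoin_adjoin]
    exact hz
  have hfg := mul_mem hf hg
  refine (Algebra.pow_smul_mem_of_smul_subset_of_mem_adjoin
    (toFrac k (f k D) * toFrac k (g k D)) _ B ?_ hadjoin hfg).imp fun n hn => hn n le_rfl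
  rintro _ ⟨x, (rfl | rfl | rfl | rfl) | rfl, rfl⟩
  · exact mul_mem hfg hf
  · simpa [hf0, mul_right_comm _ (toFrac k (g k D))] using hg
  · exact mul_mem hfg hg
  · simpa [hg0, mul_assoc] using hf
  · exact mul_mem hfg hq

theorem mem_of_toFrac_mem_Cq {B : Subalgebra k (Poly k)} {h b : Poly k} (hf : f k D ∈ B)
    (hg : g k D ∈ B) (hq : q k D p h ∈ B) (hsat : IsSaturatedAt B (f k D * g k D))
    (hb : toFrac k b ∈ Cq k D p h) : b ∈ B := by
  obtain ⟨n, c, hc, hcb⟩ := exists_pow_mul_mem_of_mem_Cq k D p (B := B.map (toFrac k))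
    ⟨_, hf, rfl⟩ ⟨_, hg, rfl⟩ ⟨_, hq, rfl⟩ hb
  refine hsat.pow n b ?_
  suffices hcb' : c = (f k D * g k D) ^ n * b from hcb' ▸ hc
  apply toFrac_injective k
  rw [map_mul, map_pow, map_mul]
  exact hcb

theorem exists_coordRel_q [hp : Fact p.Prime] [CharP k p] {h u : Poly k}
    (hu : h ^ (p - 1) = f k D ^ (D.l + 1) * g k D ^ 2 * u) :
    ∃ y, CoordRel D (f k D ^ p) (g k D ^ p) (q k D p h) y ∧
      ∀ i, f k D * g k D ∣ y i - MvPolynomial.X i ^ p := by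
  have hf := pow_sub_one_mul hp.out.ne_zero (f k D ^ D.l)
  have hg := pow_sub_one_mul hp.out.ne_zero (g k D)
  have hq : q k D p h = r k D ^ p +
      f k D * g k D * (f k D ^ p) ^ D.l * g k D ^ p * (-(u * r k D)) := by
    rw [q, mul_pow, mul_pow, hu, ← pow_mul (f k D) p, mul_comm p, pow_mul (f k D) D.l, ← hf, ← hg]
    ring
  rw [hq]
  exact (coordRel_X_pow k D p).exists_perturb (isRelPrime_X_f k D).pow
    ((isRelPrime_X_f k D).mul_right (isRelPrime_X_g k D)).pow_left

/-- `r ^ p` as an element of `C[r ^ p]`. -/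
noncomputable def rpCrp : Crp k D p := ⟨toFrac k (r k D) ^ p, Algebra.subset_adjoin rfl⟩

variable [hp : Fact p.Prime] (h : Poly k)

theorem psiFrac_mem_Cq (a : Crp k D p) : psiFrac k D p h a ∈ Cq k D p h :=
  (psi k D p h a).2

theorem psiFrac_fCrp : psiFrac k D p h (fCrp k D p) = toFrac k (f k D) :=
  congrArg Subtype.val ((psi k D p h).commutes ⟨_, f_mem_C k D⟩)

theorem psiFrac_gCrp : psiFrac k D p h (gCrp k D p) = toFrac k (g k D) :=
  congrArg Subtype.val ((psi k D p h).commutes ⟨_, g_mem_C k D⟩)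

theorem psiFrac_rpCrp : psiFrac k D p h (rpCrp k D p) = toFrac k (q k D p h) :=
  congrArg Subtype.val (subst_gen ((transcendental_r k D).pow hp.out.pos) (Crp k D p) rfl
    (⟨toFrac k (q k D p h), Algebra.subset_adjoin rfl⟩ : Cq k D p h) (rpCrp k D p).2)

variable [CharP k p]

theorem coordRel_xPow : CoordRel D (fCrp k D p ^ p) (gCrp k D p ^ p) (rpCrp k D p)
    (xPow k D p) := by
  have hX := (coordRel_X_pow k D p).map (toFrac k : Poly k →+* Frac k)
  simp only [RingHom.coe_coe, map_pow] at hX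
  exact ⟨Subtype.ext hX.mul_zero_eq, Subtype.ext hX.mul_one_add, Subtype.ext hX.zero_mul_two⟩

theorem xPow_ne_zero (i : Fin 3) : xPow k D p i ≠ 0 := by
  intro hzero
  refine pow_ne_zero p (MvPolynomial.X_ne_zero i) (toFrac_injective k ?_)
  rw [map_pow, map_zero]
  exact congrArg Subtype.val hzero

variable {h}

theorem psiFrac_xPow (hh : toFrac k h ∈ C k D) {y : Fin 3 → Poly k}
    (hy : CoordRel D (f k D ^ p) (g k D ^ p) (q k D p h) y) (i : Fin 3) :
    psiFrac k D p h (xPow k D p i) = toFrac k (y i) := by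
  have hx := (coordRel_xPow k D p).map (psiFrac k D p h : Crp k D p →+* Frac k)
  have hy' := hy.map (toFrac k : Poly k →+* Frac k)
  simp only [RingHom.coe_coe, map_pow, psiFrac_fCrp, psiFrac_gCrp, psiFrac_rpCrp] at hx hy'
  refine congrFun (hx.eq hy' (pow_ne_zero p (tf_ne_zero k D)) (pow_ne_zero p (tg_ne_zero k D)) ?_) i
  exact (map_ne_zero_iff _ (psiFrac_injective k D p hh)).2 (xPow_ne_zero k D p 0)

theorem psiFrac_comp_fiveHom (hh : toFrac k h ∈ C k D) {y : Fin 3 → Poly k}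
    (hy : CoordRel D (f k D ^ p) (g k D ^ p) (q k D p h) y) :
    (psiFrac k D p h).comp (fiveHom (xPow k D p) (fCrp k D p) (gCrp k D p)) =
      (toFrac k).comp (fiveHom y (f k D) (g k D)) := by
  simp only [comp_fiveHom, psiFrac_fCrp, psiFrac_gCrp, psiFrac_xPow k D p hh hy]

theorem ker_fiveHom_of_coordRel_q (hpt : ¬ p ∣ D.t) (hh : toFrac k h ∈ C k D)
    {y : Fin 3 → Poly k} (hy : CoordRel D (f k D ^ p) (g k D ^ p) (q k D p h) y) :
    RingHom.ker (fiveHom (k := k) y (f k D) (g k D)) = relIdeal k D p := by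
  have hcomp : ((Crp k D p).val.restrictScalars k).comp
      (fiveHom (xPow k D p) (fCrp k D p) (gCrp k D p)) =
        (toFrac k).comp (fiveHom (fun i => MvPolynomial.X i ^ p) (f k D) (g k D)) := by
    simp only [comp_fiveHom, map_pow]
    rfl
  rw [← ker_fiveHom_X_pow k D p hpt]
  ext P
  have hψ := DFunLike.congr_fun (psiFrac_comp_fiveHom k D p hh hy) P
  have hval := DFunLike.congr_fun hcomp P
  simp only [AlgHom.comp_apply] at hψ hval
  rw [RingHom.mem_ker, RingHom.mem_ker, ← map_eq_zero_iff _ (toFrac_injective k), ← hψ,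
    map_eq_zero_iff _ (psiFrac_injective k D p hh), ← map_eq_zero_iff _ (toFrac_injective k),
    ← hval]
  exact (map_eq_zero_iff (Crp k D p).val Subtype.val_injective).symm

theorem isSaturatedAt_range_fiveHom_of_coordRel_q (hpt : ¬ p ∣ D.t)
    (hpmt : ¬ p ∣ D.m * D.t - 1) (hh : toFrac k h ∈ C k D) {y : Fin 3 → Poly k}
    (hy : CoordRel D (f k D ^ p) (g k D ^ p) (q k D p h) y)
    (hdvd : ∀ i, f k D * g k D ∣ y i - MvPolynomial.X i ^ p) :
    IsSaturatedAt (fiveHom (k := k) y (f k D) (g k D)).range (f k D * g k D) := by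
  refine (isSaturatedAt_range_fiveHom_X_pow k D p hpt hpmt).range_of_dvd_sub
    (z := MvPolynomial.X 3 * MvPolynomial.X 4) (mul_ne_zero (f_ne_zero k D) (g_ne_zero k D))
    (by simp [fiveHom]) (by simp [fiveHom]) (fun P hP => ?_) (fun P => ?_)
  · rw [← RingHom.mem_ker] at hP ⊢
    rwa [ker_fiveHom_of_coordRel_q k D p hpt hh hy, ← ker_fiveHom_X_pow k D p hpt]
  · refine dvd_aeval_sub_aeval (fun i => ?_) P
    fin_cases i
    exacts [dvd_sub_comm.1 (hdvd 0), dvd_sub_comm.1 (hdvd 1), dvd_sub_comm.1 (hdvd 2), by simp,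
      by simp]

theorem invariants_eq_range_fiveHom (hpt : ¬ p ∣ D.t) (hpmt : ¬ p ∣ D.m * D.t - 1)
    (hh : toFrac k h ∈ C k D) (h0 : h ≠ 0) {y : Fin 3 → Poly k}
    (hy : CoordRel D (f k D ^ p) (g k D ^ p) (q k D p h) y)
    (hdvd : ∀ i, f k D * g k D ∣ y i - MvPolynomial.X i ^ p) :
    invariants k (epsilonAt k D h) = (fiveHom (k := k) y (f k D) (g k D)).range := by
  apply le_antisymm
  · have hsat := isSaturatedAt_range_fiveHom_of_coordRel_q k D p hpt hpmt hh hy hdvd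
    have hmem (i : Fin 5) : ![y 0, y 1, y 2, f k D, g k D] i ∈
        (fiveHom (k := k) y (f k D) (g k D)).range :=
      ⟨MvPolynomial.X i, MvPolynomial.aeval_X _ _⟩
    have hq : q k D p h ∈ (fiveHom (k := k) y (f k D) (g k D)).range := by
      rw [← hy.mul_one_add]
      exact add_mem (mul_mem (pow_mem (pow_mem (hmem 3) p) _) (hmem 1)) (pow_mem (hmem 0) _)
    intro b hb
    exact mem_of_toFrac_mem_Cq k D p (hmem 3) (hmem 4) hq hsat
      ((mem_invariants_epsilonAt_iff k D p hh h0).1 hb)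
  · rintro _ ⟨P, rfl⟩
    refine (mem_invariants_epsilonAt_iff k D p hh h0).2 ?_
    have hψ := DFunLike.congr_fun (psiFrac_comp_fiveHom k D p hh hy) P
    exact Eq.subst (motive := (· ∈ Cq k D p h)) hψ (psiFrac_mem_Cq k D p h _)

end Invariants

section RelIdeal

variable (k : Type*) [Field k] (D : Params)

theorem X_mem_ker_constantCoeff {σ : Type*} (i : σ) :
    MvPolynomial.X i ∈ RingHom.ker (MvPolynomial.constantCoeff (σ := σ) (R := k)) :=
  MvPolynomial.constantCoeff_X k i

theorem f_mem_sq_ker_constantCoeff :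
    f k D ∈ RingHom.ker (MvPolynomial.constantCoeff (σ := Fin 3) (R := k)) ^ 2 := by
  have hX := X_mem_ker_constantCoeff k (σ := Fin 3)
  refine sub_mem ?_ ?_
  · rw [sq]
    exact Ideal.mul_mem_mul (hX 0) (hX 2)
  · exact Ideal.pow_le_pow_right D.two_le_t (Ideal.pow_mem_pow (hX 1) _)

theorem g_mem_sq_ker_constantCoeff :
    g k D ∈ RingHom.ker (MvPolynomial.constantCoeff (σ := Fin 3) (R := k)) ^ 2 := by
  set M := RingHom.ker (MvPolynomial.constantCoeff (σ := Fin 3) (R := k))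
  have hX (i : Fin 3) : MvPolynomial.X i ∈ M := X_mem_ker_constantCoeff k i
  have hf := f_mem_sq_ker_constantCoeff k D
  have hr : r k D ∈ M := add_mem (M.mul_mem_left _ (hX 1))
    (M.pow_mem_of_mem (hX 0) _ D.one_le_m)
  have hdeg : 2 ≤ D.m - 1 + (D.t - 1) := by
    have hm := D.one_le_m
    have ht := D.two_le_t
    have hmt := D.three_le_mt
    rcases hm.eq_or_lt with h1 | h1
    · rw [← h1] at hmt
      omega
    · omega
  refine add_mem (Ideal.mul_mem_right _ _ ?_) (Ideal.pow_le_pow_right hdeg ?_)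
  · exact Ideal.pow_mem_of_mem _ hf _ (Nat.mul_pos D.one_le_l (by have := D.two_le_t; omega))
  rw [pow_add]
  refine Ideal.mul_mem_mul (Ideal.pow_mem_pow (hX 0) _) (sum_mem fun i hi => ?_)
  have hi : D.t - 1 = i + (D.t - 1 - i) := by
    have := Finset.mem_range.1 hi
    omega
  rw [hi, pow_add, ← hi]
  exact Ideal.mul_mem_mul (Ideal.pow_mem_pow hr _)
    (Ideal.pow_mem_pow (M.mul_mem_left _ (hX 1)) _)

theorem relIdeal_le_sq_ker_constantCoeff {p : ℕ} (hp : 2 ≤ p) :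
    relIdeal k D p ≤ RingHom.ker (MvPolynomial.constantCoeff (σ := Fin 5) (R := k)) ^ 2 := by
  have hpow (i : Fin 5) := Ideal.pow_le_pow_right hp
    (Ideal.pow_mem_pow (X_mem_ker_constantCoeff k i) p)
  have hrename {P : Poly k} (hP : P ∈ RingHom.ker MvPolynomial.constantCoeff ^ 2) :
      MvPolynomial.rename (Fin.castAdd 2) P ∈
        RingHom.ker (MvPolynomial.constantCoeff (σ := Fin 5) (R := k)) ^ 2 := by
    have hle : RingHom.ker (MvPolynomial.constantCoeff (σ := Fin 3) (R := k)) ≤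
        (RingHom.ker MvPolynomial.constantCoeff).comap
          (MvPolynomial.rename (R := k) (Fin.castAdd 2)) := fun Q hQ =>
      (MvPolynomial.constantCoeff_rename _ Q).trans hQ
    exact (Ideal.pow_right_mono hle 2).trans (Ideal.le_comap_pow _ 2) hP
  rw [relIdeal, Ideal.span_le]
  rintro _ (rfl | rfl)
  · exact sub_mem (hpow 3) (hrename (f_mem_sq_ker_constantCoeff k D))
  · exact sub_mem (hpow 4) (hrename (g_mem_sq_ker_constantCoeff k D))

theorem isEmpty_quotient_relIdeal_algEquiv {p : ℕ} (hp : 2 ≤ p) :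
    IsEmpty ((MvPolynomial (Fin 5) k ⧸ relIdeal k D p) ≃ₐ[k] MvPolynomial (Fin 3) k) := by
  refine ⟨fun e => ?_⟩
  have hcard := card_le_card_of_quotient_algEquiv (relIdeal_le_sq_ker_constantCoeff k D hp) e
  simp at hcard

end RelIdeal

end RankThree

theorem mainTheorem7 (k : Type*) [Field k] (p : ℕ) [Fact p.Prime] [CharP k p]
    (D : RankThree.Params) (hpt : ¬ p ∣ D.t) (hpmt : ¬ p ∣ D.m * D.t - 1)
    (h : RankThree.Poly k) (hinv : h ∈ RankThree.epsilonInvariants k D)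
    (hh : ∃ u ∈ Algebra.adjoin k {RankThree.f k D, RankThree.g k D},
      h ^ (p - 1) = RankThree.f k D ^ (D.l + 1) * RankThree.g k D ^ 2 * u)
    (hh0 : h ^ (p - 1) ≠ 0) :
    ((RankThree.invariants k (RankThree.epsilonAt k D h)).map (RankThree.toFrac k) =
        (Algebra.adjoin k {RankThree.xPow k D p 0, RankThree.xPow k D p 1,
          RankThree.xPow k D p 2, RankThree.fCrp k D p, RankThree.gCrp k D p}).map
            (RankThree.psiFrac k D p h) ∧
      (RankThree.invariants k (RankThree.epsilonAt k D h)).map (RankThree.toFrac k) =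
        Algebra.adjoin k {RankThree.psiFrac k D p h (RankThree.xPow k D p 0),
          RankThree.psiFrac k D p h (RankThree.xPow k D p 1),
          RankThree.psiFrac k D p h (RankThree.xPow k D p 2),
          RankThree.toFrac k (RankThree.f k D), RankThree.toFrac k (RankThree.g k D)}) ∧
    (Nonempty (RankThree.invariants k (RankThree.epsilonAt k D h) ≃ₐ[k]
        (MvPolynomial (Fin 5) k ⧸ RankThree.relIdeal k D p)) ∧
      ¬ Nonempty (RankThree.invariants k (RankThree.epsilonAt k D h) ≃ₐ[k]
        MvPolynomial (Fin 3) k)) := by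
  open RankThree in
  obtain ⟨u, -, hu⟩ := hh
  have hp : p.Prime := Fact.out
  have h0 : h ≠ 0 := ne_zero_pow (Nat.sub_ne_zero_of_lt hp.one_lt) hh0
  have hC : toFrac k h ∈ C k D := toFrac_mem_C_of_mem_epsilonInvariants k D hinv
  obtain ⟨y, hy, hdvd⟩ := exists_coordRel_q k D p hu
  rw [invariants_eq_range_fiveHom k D p hpt hpmt hC h0 hy hdvd]
  have hψ : (fiveHom (k := k) y (f k D) (g k D)).range.map (toFrac k) =
      (fiveHom (xPow k D p) (fCrp k D p) (gCrp k D p)).range.map (psiFrac k D p h) := by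
    rw [← AlgHom.range_comp, ← AlgHom.range_comp, psiFrac_comp_fiveHom k D p hC hy]
  have e : (fiveHom (k := k) y (f k D) (g k D)).range ≃ₐ[k]
      (MvPolynomial (Fin 5) k ⧸ relIdeal k D p) :=
    (Ideal.quotientKerEquivRange _).symm.trans
      (Ideal.quotientEquivAlgOfEq k (ker_fiveHom_of_coordRel_q k D p hpt hC hy))
  refine ⟨⟨by rw [hψ, range_fiveHom], ?_⟩, ⟨e⟩, fun ⟨e'⟩ => ?_⟩
  · rw [hψ, ← AlgHom.range_comp, comp_fiveHom, range_fiveHom, psiFrac_fCrp, psiFrac_gCrp]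
  · exact (isEmpty_quotient_relIdeal_algEquiv k D hp.two_le).false (e.symm.trans e')
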